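/- Let $0<\varepsilon<\frac1{85}$ and let $k$ be an integer with $k\ge \frac{2}{\varepsilon^2}$. There is $n_0=n_0(\varepsilon,k)$ such that the following holds for every $n\ge n_0$. Let $G_0$ be a (finite simple) graph on $n$ vertices, and let $\Pi=(V_1,\dots,V_k)$ be a partition of its vertex set with $\big||V_i|-|V_j|\big|\le 1$ for all $i,j\in[k]$. Put $m=\frac nk$. Let $S=S(G_0,\Pi,\varepsilon)$ be the $\varepsilon$-graph of $\Pi$: its vertex set is $[k]$, and distinct $i,j$ are adjacent in $S$ if and only if for all $U_1\subseteq V_i$ and $U_2\subseteq V_j$ with $|U_1|,|U_2|\ge\varepsilon m$ there is an edge of $G_0$ between $U_1$ and $U_2$. Then for every real constant $C_1>2.1$: 1. If $S$ contains a path of odd length $b$, where $1\le b<k$, then $G_0$ contains cycles of all even lengths in $$\left[\frac{C_1}{\log(1/\varepsilon)}\log n,\ (1-48\varepsilon)\,\frac{b+1}{k}\,n\right].$$ 2. If $S$ contains a cycle of odd length $b$, where $3\le b<k$, then $G_0$ contains cycles of all odd lengths in $$\left[\frac{(b-1)C_1}{2\log(1/\varepsilon)}\log n,\ (1-48\varepsilon)\,\frac{b}{k}\,n\right].$$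 Here the length of a path or a cycle is its number of edges. -/

import Mathlib

namespace KeyLemma

/-- An ordered partition `(V₁, …, V_k)` of the vertex set whose part sizes differ by at most 1. -/
structure BalancedPartition (V : Type*) [Fintype V] (k : ℕ) where
  part : Fin k → Finset V
  disjoint : ∀ i j, i ≠ j → Disjoint (part i) (part j)
  cover : ∀ v, ∃ i, v ∈ part i
  balanced : ∀ i j, (part i).card ≤ (part j).card + 1

/-- The pair `(A, B)` has the `ε`-property in `G` with respect to the size parameter `m`:
any two subsets `U₁ ⊆ A` and `U₂ ⊆ B` of size at least `ε m` span an edge of `G`. -/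
def EpsProperty {V : Type*} (G : SimpleGraph V) (ε m : ℝ) (A B : Finset V) : Prop :=
  ∀ U₁ ⊆ A, ∀ U₂ ⊆ B, ε * m ≤ (U₁.card : ℝ) → ε * m ≤ (U₂.card : ℝ) →
    ∃ u ∈ U₁, ∃ v ∈ U₂, G.Adj u v

theorem EpsProperty.symm {V : Type*} {G : SimpleGraph V} {ε m : ℝ} {A B : Finset V}
    (h : EpsProperty G ε m A B) : EpsProperty G ε m B A := by
  intro U₁ h₁ U₂ h₂ c₁ c₂
  obtain ⟨u, hu, v, hv, huv⟩ := h U₂ h₂ U₁ h₁ c₂ c₁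
  exact ⟨v, hv, u, hu, huv.symm⟩

/-- The `ε`-graph `S(G, Π, ε)` on the index set of the partition, with `m = n / k`. -/
def epsGraph {V : Type*} [Fintype V] {k : ℕ} (G : SimpleGraph V) (P : BalancedPartition V k)
    (ε : ℝ) : SimpleGraph (Fin k) where
  Adj i j := i ≠ j ∧ EpsProperty G ε ((Fintype.card V : ℝ) / (k : ℝ)) (P.part i) (P.part j)
  symm := ⟨fun _ _ h => ⟨h.1.symm, h.2.symm⟩⟩
  loopless := ⟨fun _ h => h.1 rfl⟩

/-- `G` contains a path with exactly `b` edges. -/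
def HasPathOfLength {V : Type*} (G : SimpleGraph V) (b : ℕ) : Prop :=
  ∃ (u v : V) (p : G.Walk u v), p.IsPath ∧ p.length = b

/-- `G` contains a cycle with exactly `t` edges. -/
def HasCycleOfLength {V : Type*} (G : SimpleGraph V) (t : ℕ) : Prop :=
  ∃ (u : V) (c : G.Walk u u), c.IsCycle ∧ c.length = t

end KeyLemma

/-!
Let `m = n / k` and `q = ⌈ε * m⌉`. Adjacent clusters of the `ε`-graph are `q`-joined (`Joined`): any
`q` vertices of one and any `q` vertices of the other span an edge. A cycle of prescribed length is
assembled from a segment of a long path and a connection of logarithmic length between the ends of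
the segment, drawn from vertices that the path does not use (`Layout.hasCycleOfLength`). The length
of the connection is fixed in advance, so the length of the cycle is adjusted through the segment.

*The long path.* Depth-first search in a `q`-joined pair finds an alternating path that misses only
about `2 * q` vertices of either side (`exists_long_chain`). Along a path of clusters of odd length,
the clusters are paired up, and the alternating paths of successive pairs are linked by single edges
(`exists_linked_seq`). For an odd cycle of `b` clusters, each cluster is halved and the `2 * b` halves
are paired up by going round the cycle twice.

*The connection.* A `q`-joined pair of reserved sets contains a pair in which small sets expand by a
factor `d + 4` (`Joined.exists_expands`). Two disjoint trees of the same depth `h`, about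
`log n / log d`, grow there from neighbours of the two ends of the segment until both have `q` leaves
(`exists_twoTrees_odd`); no embedding theorem for trees is needed, since geometric growth keeps the
number of used vertices below the expansion. The leaves of the first tree are led through further
reserved sets, one vertex in each cluster on the way, towards the cluster of the leaves of the second
tree (`exists_reach_chain`), and a final edge joins the two. Going round an odd cycle of clusters
changes the parity. Fewer than `q` vertices of a cluster have no neighbour in an expanding set, so
among `2 * q` translates of the segment one has good vertices at both ends.

*Constants.* For `t > q / 20` it is enough to expand by a constant factor, and small reserved sets
suffice; the bounds stay within the `48 * ε` lost at the upper end. For `t ≤ q / 20` the segment is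
short, a single pair is needed for it, and nearly all of that pair is reserved. The branching factor
is then `d ≥ 14 / (17 * ε)`, for which `2 / log d < 2.1 / log (1 / ε)` (`two_div_log_lt`), and this gives
the constant at the lower end. The remaining error terms are absorbed for large `n`
(`exists_parameters`).
-/

namespace KeyLemma

section

variable {V : Type*} {G : SimpleGraph V}

/-! ### Joined pairs -/

/-- The pair `(A, B)` is `q`-joined: any `q` vertices of `A` and `q` vertices of `B` span an edge. -/
def Joined (G : SimpleGraph V) (q : ℕ) (A B : Finset V) : Prop :=
  ∀ X ⊆ A, ∀ Y ⊆ B, q ≤ X.card → q ≤ Y.card → ∃ x ∈ X, ∃ y ∈ Y, G.Adj x y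

theorem Joined.symm {q : ℕ} {A B : Finset V} (h : Joined G q A B) : Joined G q B A := by
  intro X hX Y hY cX cY
  obtain ⟨y, hy, x, hx, e⟩ := h Y hY X hX cY cX
  exact ⟨x, hx, y, hy, e.symm⟩

theorem Joined.mono {q : ℕ} {A B A' B' : Finset V} (h : Joined G q A B) (hA : A' ⊆ A)
    (hB : B' ⊆ B) : Joined G q A' B' :=
  fun X hX Y hY => h X (hX.trans hA) Y (hY.trans hB)

open Classical in
/-- The vertices of `B` that have a neighbour in `X`. -/
noncomputable def nbrs (G : SimpleGraph V) (X B : Finset V) : Finset V :=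
  B.filter fun v => ∃ x ∈ X, G.Adj x v

theorem mem_nbrs {X B : Finset V} {v : V} :
    v ∈ nbrs G X B ↔ v ∈ B ∧ ∃ x ∈ X, G.Adj x v := by
  simp [nbrs]

theorem nbrs_subset {X B : Finset V} : nbrs G X B ⊆ B := fun _ h => (mem_nbrs.1 h).1

/-! ### Paths confined to a vertex set -/

/-- There is a path of length `l` from `u` to `v` all of whose vertices lie in `T`. -/
def PathIn (G : SimpleGraph V) (T : Finset V) (u v : V) (l : ℕ) : Prop :=
  ∃ p : G.Walk u v, p.IsPath ∧ p.length = l ∧ ∀ z ∈ p.support, z ∈ T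

theorem PathIn.single {T : Finset V} {u : V} (h : u ∈ T) : PathIn G T u u 0 :=
  ⟨.nil, by simp, by simp, by simpa using h⟩

theorem PathIn.mono {T T' : Finset V} {u v : V} {l : ℕ} (h : PathIn G T u v l) (hT : T ⊆ T') :
    PathIn G T' u v l := by
  obtain ⟨p, h1, h2, h3⟩ := h
  exact ⟨p, h1, h2, fun z hz => hT (h3 z hz)⟩

theorem PathIn.symm {T : Finset V} {u v : V} {l : ℕ} (h : PathIn G T u v l) :
    PathIn G T v u l := by
  obtain ⟨p, h1, h2, h3⟩ := h
  exact ⟨p.reverse, h1.reverse, by simpa using h2, by simpa using h3⟩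

theorem PathIn.hasCycleOfLength {T : Finset V} {u v : V} {l : ℕ} (h : PathIn G T u v l)
    (e : G.Adj v u) (hl : 2 ≤ l) : HasCycleOfLength G (l + 1) := by
  obtain ⟨p, p1, p2, -⟩ := h
  refine ⟨v, .cons e p, ?_, by simp [p2]⟩
  rw [SimpleGraph.Walk.cons_isCycle_iff]
  refine ⟨p1, fun hmem => ?_⟩
  -- an edge between the ends of a path forces the path to be that edge
  have := p1.length_eq_one_of_mem_edges (by rwa [Sym2.eq_swap] at hmem)
  omega

/-- Every vertex of `X` is the end of a path of length `l` from `x` inside `T`. -/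
def Reach (G : SimpleGraph V) (x : V) (T : Finset V) (l : ℕ) (X : Finset V) : Prop :=
  ∀ v ∈ X, PathIn G T x v l

variable [DecidableEq V]

/-- Two paths in disjoint vertex sets are joined by an edge between their ends. -/
theorem PathIn.join {T₁ T₂ : Finset V} {u v w z : V} {a b : ℕ} (h₁ : PathIn G T₁ u v a)
    (e : G.Adj v w) (h₂ : PathIn G T₂ w z b) (hd : Disjoint T₁ T₂) :
    PathIn G (T₁ ∪ T₂) u z (a + 1 + b) := by
  obtain ⟨p, p1, p2, p3⟩ := h₁
  obtain ⟨r, r1, r2, r3⟩ := h₂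
  refine ⟨p.append (.cons e r), ?_, ?_, ?_⟩
  · rw [SimpleGraph.Walk.isPath_def, SimpleGraph.Walk.support_append]
    simp only [SimpleGraph.Walk.support_cons, List.tail_cons]
    rw [List.nodup_append]
    refine ⟨p1.support_nodup, r1.support_nodup, ?_⟩
    intro x hx y hy hxy
    subst hxy
    exact Finset.disjoint_left.1 hd (p3 _ hx) (r3 _ hy)
  · simp [p2, r2]; omega
  · intro x hx
    rw [SimpleGraph.Walk.mem_support_append_iff, SimpleGraph.Walk.support_cons,
      List.mem_cons] at hx
    rw [Finset.mem_union]
    rcases hx with hx | rfl | hx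
    · exact .inl (p3 _ hx)
    · exact .inl (p3 _ p.end_mem_support)
    · exact .inr (r3 _ hx)

/-- A segment of an injective sequence of consecutively adjacent vertices is a path. -/
theorem PathIn.of_seq {p : ℕ → V} {L : ℕ} (hinj : Set.InjOn p (Set.Iio L))
    (hadj : ∀ i, i + 1 < L → G.Adj (p i) (p (i + 1))) (i s : ℕ) (h : i + s < L) :
    PathIn G ((Finset.Icc i (i + s)).image p) (p i) (p (i + s)) s := by
  induction s with
  | zero => exact .single (by simp)
  | succ s ih =>
    have := (ih (by omega)).join (hadj (i + s) (by omega))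
      (PathIn.single (Finset.mem_singleton_self (p (i + s + 1)))) (by
        rw [Finset.disjoint_singleton_right, Finset.mem_image]
        rintro ⟨x, hx, hxe⟩
        rw [Finset.mem_Icc] at hx
        have := hinj (Set.mem_Iio.2 (by omega)) (Set.mem_Iio.2 (by omega)) hxe
        omega)
    refine this.mono ?_
    intro x hx
    simp only [Finset.mem_union, Finset.mem_image, Finset.mem_Icc, Finset.mem_singleton] at hx ⊢
    rcases hx with ⟨y, hy, rfl⟩ | rfl
    · exact ⟨y, by omega, rfl⟩
    · exact ⟨i + s + 1, by omega, rfl⟩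

theorem Reach.step {x : V} {T X X' : Finset V} {l : ℕ} (h : Reach G x T l X)
    (hX : ∀ v ∈ X', ∃ u ∈ X, G.Adj u v) (hd : Disjoint T X') :
    Reach G x (T ∪ X') (l + 1) X' := by
  intro v hv
  obtain ⟨u, hu, e⟩ := hX v hv
  exact ((h u hu).join e (.single (Finset.mem_singleton_self v))
    (Finset.disjoint_of_subset_right (by simpa using hv) hd)).mono
    (Finset.union_subset_union_right (by simpa using hv))

/-! ### Expanding subpairs of joined pairs -/

/-- Every set of at most `a` vertices of `A` has at least `D` times as many neighbours in `B`. -/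
def Expands (G : SimpleGraph V) (a D : ℕ) (A B : Finset V) : Prop :=
  ∀ X ⊆ A, X.card ≤ a → D * X.card ≤ (nbrs G X B).card

/-- A set of at least `q` vertices on one side of a `q`-joined pair misses fewer than `q` vertices
of the other side. -/
theorem Joined.card_lt_card_nbrs_add {q : ℕ} {A B X : Finset V} (h : Joined G q A B) (hX : X ⊆ A)
    (hq : q ≤ X.card) : B.card < (nbrs G X B).card + q := by
  by_contra! hcon
  have h1 := Finset.card_sdiff_add_card_eq_card (nbrs_subset (G := G) (X := X) (B := B))
  obtain ⟨x, hx, y, hy, e⟩ := h X hX (B \ nbrs G X B) Finset.sdiff_subset hq (by omega)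
  rw [Finset.mem_sdiff] at hy
  exact hy.2 (mem_nbrs.2 ⟨hy.1, x, hx, e⟩)

/-- One half of the maximality argument for `Joined.exists_expands`: if a small subset `X'` of
`R₀ \ X` does not expand into `R₁ \ Y`, then `X ∪ X'` is again a set with few neighbours, and it
is still smaller than `q`. -/
theorem Joined.card_union_lt {q a D : ℕ} {R₀ R₁ X Y X' : Finset V} (hJ : Joined G q R₀ R₁)
    (h₁ : D * (q + a) + 2 * q ≤ R₁.card) (hX : X ⊆ R₀) (hXq : X.card < q) (hYq : Y.card < q)
    (hXD : (nbrs G X (R₁ \ Y)).card ≤ D * X.card) (hX' : X' ⊆ R₀ \ X) (hX'a : X'.card ≤ a)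
    (hbad : (nbrs G X' (R₁ \ Y)).card < D * X'.card) :
    (X ∪ X').card = X.card + X'.card ∧ (X ∪ X').card < q ∧
      (nbrs G (X ∪ X') (R₁ \ Y)).card ≤ D * (X ∪ X').card := by
  have hcard : (X ∪ X').card = X.card + X'.card :=
    Finset.card_union_of_disjoint
      (Finset.disjoint_of_subset_right hX' Finset.disjoint_sdiff)
  have hN : (nbrs G (X ∪ X') (R₁ \ Y)).card ≤ D * (X ∪ X').card := by
    have hsub : nbrs G (X ∪ X') (R₁ \ Y) ⊆ nbrs G X (R₁ \ Y) ∪ nbrs G X' (R₁ \ Y) := by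
      intro v hv
      rw [mem_nbrs] at hv
      obtain ⟨hv, u, hu, e⟩ := hv
      rw [Finset.mem_union, mem_nbrs, mem_nbrs]
      rcases Finset.mem_union.1 hu with hu | hu
      · exact .inl ⟨hv, u, hu, e⟩
      · exact .inr ⟨hv, u, hu, e⟩
    have := (Finset.card_le_card hsub).trans (Finset.card_union_le _ _)
    rw [hcard, mul_add]
    omega
  refine ⟨hcard, ?_, hN⟩
  by_contra! hq
  have h2 := (hJ.mono (Finset.Subset.refl _) (Finset.sdiff_subset (t := Y))).card_lt_card_nbrs_add
    (Finset.union_subset hX (hX'.trans Finset.sdiff_subset)) hq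
  have h3 := Finset.le_card_sdiff Y R₁
  have h4 : D * (X ∪ X').card ≤ D * (q + a) := Nat.mul_le_mul_left _ (by omega)
  omega

/-- A `q`-joined pair of large sets contains a pair in which small sets expand in both
directions. -/
theorem Joined.exists_expands {q a D : ℕ} {R₀ R₁ : Finset V} (hq : 0 < q)
    (hJ : Joined G q R₀ R₁)
    (h₀ : D * (q + a) + 2 * q ≤ R₀.card) (h₁ : D * (q + a) + 2 * q ≤ R₁.card) :
    ∃ A ⊆ R₀, ∃ B ⊆ R₁, q ≤ A.card ∧ q ≤ B.card ∧ Expands G a D A B ∧ Expands G a D B A := by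
  classical
  -- remove a maximal pair of small non-expanding sets
  let F : Finset (Finset V × Finset V) := (R₀.powerset ×ˢ R₁.powerset).filter fun z =>
    z.1.card < q ∧ z.2.card < q ∧ (nbrs G z.1 (R₁ \ z.2)).card ≤ D * z.1.card ∧
      (nbrs G z.2 (R₀ \ z.1)).card ≤ D * z.2.card
  have hF : F.Nonempty := ⟨(∅, ∅), by
    simp [F, hq, Finset.card_eq_zero, Finset.eq_empty_iff_forall_notMem, mem_nbrs]⟩
  obtain ⟨⟨X, Y⟩, hm, hmax⟩ := F.exists_max_image (fun z => z.1.card + z.2.card) hF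
  simp only [F, Finset.mem_filter, Finset.mem_product, Finset.mem_powerset] at hm hmax
  obtain ⟨⟨hX, hY⟩, hXq, hYq, hXD, hYD⟩ := hm
  have mono : ∀ {S T T' : Finset V}, T ⊆ T' → (nbrs G S T).card ≤ (nbrs G S T').card := by
    intro S T T' h
    refine Finset.card_le_card fun v hv => ?_
    rw [mem_nbrs] at hv ⊢
    exact ⟨h hv.1, hv.2⟩
  have c0 := Finset.le_card_sdiff X R₀
  have c1 := Finset.le_card_sdiff Y R₁
  refine ⟨R₀ \ X, Finset.sdiff_subset, R₁ \ Y, Finset.sdiff_subset, by omega, by omega, ?_, ?_⟩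
  · intro X' hX' ha
    by_contra! hbad
    obtain ⟨e1, e2, e3⟩ := hJ.card_union_lt h₁ hX hXq hYq hXD hX' ha hbad
    have := hmax (X ∪ X', Y) ⟨⟨Finset.union_subset hX (hX'.trans Finset.sdiff_subset), hY⟩, e2,
      hYq, e3, (mono (Finset.sdiff_subset_sdiff (Finset.Subset.refl _)
        Finset.subset_union_left)).trans hYD⟩
    have h0 : X'.card ≠ 0 := by rintro h; simp [h] at hbad
    simp only at this
    omega
  · intro Y' hY' ha
    by_contra! hbad
    obtain ⟨e1, e2, e3⟩ := hJ.symm.card_union_lt h₀ hY hYq hXq hYD hY' ha hbad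
    have := hmax (X, Y ∪ Y') ⟨⟨hX, Finset.union_subset hY (hY'.trans Finset.sdiff_subset)⟩, hXq,
      e2, (mono (Finset.sdiff_subset_sdiff (Finset.Subset.refl _)
        Finset.subset_union_left)).trans hXD, e3⟩
    have h0 : Y'.card ≠ 0 := by rintro h; simp [h] at hbad
    simp only at this
    omega

/-! ### Growing two disjoint trees -/

/-- Two disjoint trees with roots `x` and `y`, grown to depth `h` in the pair `(A, B)`: their
last levels `X ⊆ A` and `Y ⊆ B` have `s` vertices each, and the trees together occupy at most `u`
vertices of each side. The trees are recorded only through their vertex sets and `Reach`. -/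
def TwoTrees (G : SimpleGraph V) (x y : V) (h s u : ℕ) (A B : Finset V) : Prop :=
  ∃ X ⊆ A, ∃ Y ⊆ B, ∃ S T : Finset V, S ⊆ A ∪ B ∧ T ⊆ A ∪ B ∧ Disjoint S T ∧
    X.card = s ∧ Y.card = s ∧ ((S ∪ T) ∩ A).card ≤ u ∧ ((S ∪ T) ∩ B).card ≤ u ∧
    Reach G x S h X ∧ Reach G y T h Y

theorem TwoTrees.step {x y : V} {h s u s' a D : ℕ} {A B : Finset V} (hT : TwoTrees G x y h s u A B)
    (hAB : Disjoint A B) (eA : Expands G a D A B) (eB : Expands G a D B A) (hs : s ≤ a)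
    (hs' : s' + u ≤ D * s) : TwoTrees G x y (h + 1) s' (u + s') B A := by
  obtain ⟨X, hX, Y, hY, S, T, hS, hT, hST, cX, cY, cA, cB, rX, rY⟩ := hT
  have key : ∀ {A' B' X : Finset V}, X ⊆ A' → Expands G a D A' B' → X.card = s →
      ((S ∪ T) ∩ B').card ≤ u →
      ∃ X' ⊆ B', X'.card = s' ∧ (∀ v ∈ X', ∃ w ∈ X, G.Adj w v) ∧ Disjoint (S ∪ T) X' := by
    intro A' B' X hX hE cX cU
    have h1 := hE X hX (by omega)
    have h2 : (nbrs G X B').card ≤ (nbrs G X B' \ (S ∪ T)).card + ((S ∪ T) ∩ B').card := by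
      rw [← Finset.card_sdiff_add_card_inter (nbrs G X B') (S ∪ T)]
      refine Nat.add_le_add_left (Finset.card_le_card fun v hv => ?_) _
      rw [Finset.mem_inter] at hv ⊢
      exact ⟨hv.2, nbrs_subset hv.1⟩
    rw [cX] at h1
    obtain ⟨X', hX', c⟩ := Finset.exists_subset_card_eq
      (show s' ≤ (nbrs G X B' \ (S ∪ T)).card by omega)
    refine ⟨X', (hX'.trans Finset.sdiff_subset).trans nbrs_subset, c, fun v hv => ?_, ?_⟩
    · exact (mem_nbrs.1 (Finset.mem_sdiff.1 (hX' hv)).1).2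
    · exact Finset.disjoint_of_subset_right hX' Finset.disjoint_sdiff
  obtain ⟨X', hX', cX', nX', dX'⟩ := key hX eA cX cB
  obtain ⟨Y', hY', cY', nY', dY'⟩ := key hY eB cY cA
  have hXY : Disjoint X' Y' :=
    Finset.disjoint_of_subset_left hX' (Finset.disjoint_of_subset_right hY' hAB.symm)
  have used : ∀ {A' Z Z' : Finset V}, ((S ∪ T) ∩ A').card ≤ u → Z.card = s' →
      Disjoint Z' A' → (((S ∪ X') ∪ (T ∪ Y')) = (S ∪ T) ∪ (Z ∪ Z')) →
      (((S ∪ X') ∪ (T ∪ Y')) ∩ A').card ≤ u + s' := by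
    intro A' Z Z' h1 h2 h3 h4
    rw [h4]
    have : ((S ∪ T) ∪ (Z ∪ Z')) ∩ A' ⊆ ((S ∪ T) ∩ A') ∪ Z := by
      intro v hv
      simp only [Finset.mem_inter, Finset.mem_union] at hv ⊢
      have := fun h : v ∈ Z' => Finset.disjoint_left.1 h3 h
      tauto
    have := (Finset.card_le_card this).trans (Finset.card_union_le _ _)
    omega
  rw [Finset.disjoint_union_left] at dX' dY'
  refine ⟨X', hX', Y', hY', S ∪ X', T ∪ Y', ?_, ?_, ?_, cX', cY', ?_, ?_,
    rX.step nX' dX'.1, rY.step nY' dY'.2⟩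
  · rw [Finset.union_comm B A]
    exact Finset.union_subset hS (hX'.trans Finset.subset_union_right)
  · rw [Finset.union_comm B A]
    exact Finset.union_subset hT (hY'.trans Finset.subset_union_left)
  · rw [Finset.disjoint_union_left, Finset.disjoint_union_right, Finset.disjoint_union_right]
    exact ⟨⟨hST, dY'.1⟩, dX'.2.symm, hXY⟩
  · refine used (Z := X') (Z' := Y') cB cX' (Finset.disjoint_of_subset_left hY' hAB) ?_
    ext v; simp only [Finset.mem_union]; tauto
  · refine used (Z := Y') (Z' := X') cA cY' (Finset.disjoint_of_subset_left hX' hAB.symm) ?_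
    ext v; simp only [Finset.mem_union]; tauto

theorem TwoTrees.base {x y : V} {A B : Finset V} (hAB : Disjoint A B) (hx : x ∈ A) (hy : y ∈ B) :
    TwoTrees G x y 0 1 1 A B := by
  have hxB : x ∉ B := Finset.disjoint_left.1 hAB hx
  have hyA : y ∉ A := Finset.disjoint_right.1 hAB hy
  refine ⟨{x}, by simpa, {y}, by simpa, {x}, {y}, by simp [hx], by simp [hy], ?_, by simp, by simp,
    ?_, ?_, ?_, ?_⟩
  · rw [Finset.disjoint_singleton]; rintro rfl; exact hxB hy
  · rw [Finset.card_le_one]; simp only [Finset.mem_inter, Finset.mem_union, Finset.mem_singleton]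
    rintro a ⟨rfl | rfl, h⟩ b ⟨rfl | rfl, h'⟩ <;> first | rfl | contradiction
  · rw [Finset.card_le_one]; simp only [Finset.mem_inter, Finset.mem_union, Finset.mem_singleton]
    rintro a ⟨rfl | rfl, h⟩ b ⟨rfl | rfl, h'⟩ <;> first | rfl | contradiction
  · intro v hv; rw [Finset.mem_singleton] at hv; subst hv; exact .single (by simp)
  · intro v hv; rw [Finset.mem_singleton] at hv; subst hv; exact .single (by simp)

/-- Level sizes `1, d, d², …` are maintained as long as they do not exceed `a`. The two sides are
quantified inside because they are exchanged at each step. -/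
theorem TwoTrees.pow {x y : V} {a d : ℕ} (hd : 2 ≤ d) (h : ℕ) :
    ∀ {A B : Finset V}, Disjoint A B → Expands G a (d + 4) A B → Expands G a (d + 4) B A →
      x ∈ A → y ∈ B → d ^ h ≤ a → ∃ A' B' u, u ≤ 2 * d ^ h ∧ TwoTrees G x y h (d ^ h) u A' B' ∧
        ((Even h ∧ A' = A ∧ B' = B) ∨ (Odd h ∧ A' = B ∧ B' = A)) := by
  induction h with
  | zero =>
    intro A B hAB _ _ hx hy _
    exact ⟨A, B, 1, by simp, by simpa using TwoTrees.base hAB hx hy, .inl ⟨by simp, rfl, rfl⟩⟩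
  | succ h ih =>
    intro A B hAB eA eB hx hy ha
    have hpos : 0 < d ^ h := pow_pos (by omega) _
    have hle : d ^ h ≤ d ^ (h + 1) := Nat.pow_le_pow_right (by omega) (by omega)
    have h2 : 2 * d ^ h ≤ d ^ (h + 1) := by rw [pow_succ']; exact Nat.mul_le_mul_right _ hd
    have h3 : d ^ (h + 1) + 2 * d ^ h ≤ (d + 4) * d ^ h := by rw [pow_succ', add_mul]; omega
    obtain ⟨A', B', u, hu, hT, hAB'⟩ := ih hAB eA eB hx hy (by omega)
    rcases hAB' with ⟨hh, rfl, rfl⟩ | ⟨hh, rfl, rfl⟩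
    · exact ⟨_, _, _, by omega, hT.step hAB eA eB (by omega) (s' := d ^ (h + 1)) (by omega),
        .inr ⟨hh.add_one, rfl, rfl⟩⟩
    · exact ⟨_, _, _, by omega, hT.step hAB.symm eB eA (by omega) (s' := d ^ (h + 1)) (by omega),
        .inl ⟨hh.add_one, rfl, rfl⟩⟩

/-- In an expanding pair, disjoint trees of a common odd logarithmic depth `h` grow from any `x ∈ A`
and `y ∈ B` until their last levels have `q` vertices. Level sizes are powers of `d` up to `a`, then
`a` once or twice (whichever makes the depth odd), then `q`. -/
theorem exists_twoTrees_odd (G : SimpleGraph V) {a d q : ℕ} (hd : 2 ≤ d) (ha : 0 < a) (hq : q ≤ d * a) :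
    ∃ h, Odd h ∧ h ≤ Nat.log d a + 3 ∧ ∀ {A B : Finset V} {x y : V}, Disjoint A B →
      Expands G a (d + 4) A B → Expands G a (d + 4) B A → x ∈ A → y ∈ B →
      ∃ u, TwoTrees G x y h q u B A := by
  set g := Nat.log d a with hg
  have hga : d ^ g ≤ a := Nat.pow_log_le_self d (by omega)
  have hag : a ≤ d * d ^ g := by
    rw [← pow_succ']; exact (Nat.lt_pow_succ_log_self (by omega) a).le
  have e1 : (d + 4) * d ^ g = d * d ^ g + 4 * d ^ g := by ring
  have e2 : (d + 4) * a = d * a + 4 * a := by ring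
  rcases Nat.even_or_odd g with hev | hodd
  · refine ⟨g + 3, by simpa [Nat.odd_add, parity_simps] using hev, le_rfl, ?_⟩
    intro A B x y hAB eA eB hx hy
    obtain ⟨A', B', u, hu, hT, hAB'⟩ := TwoTrees.pow hd g hAB eA eB hx hy hga
    rcases hAB' with ⟨hh, rfl, rfl⟩ | ⟨hh, -⟩
    · have t1 := hT.step hAB eA eB hga (s' := a) (by omega)
      have t2 := t1.step hAB.symm eB eA le_rfl (s' := a) (by omega)
      exact ⟨_, t2.step hAB eA eB le_rfl (s' := q) (by omega)⟩
    · exact absurd hh (Nat.not_odd_iff_even.2 hev)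
  · refine ⟨g + 2, by simpa [Nat.odd_add, parity_simps] using hodd, by omega, ?_⟩
    intro A B x y hAB eA eB hx hy
    obtain ⟨A', B', u, hu, hT, hAB'⟩ := TwoTrees.pow hd g hAB eA eB hx hy hga
    rcases hAB' with ⟨hh, -⟩ | ⟨hh, rfl, rfl⟩
    · exact absurd hodd (Nat.not_odd_iff_even.2 hh)
    · have t1 := hT.step hAB.symm eB eA hga (s' := a) (by omega)
      exact ⟨_, t1.step hAB eA eB le_rfl (s' := q) (by omega)⟩

end

section

variable {V : Type*} {G : SimpleGraph V}

/-! ### Long alternating paths -/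

/-- Adjacency across the pair `(A, B)`. -/
def CrossAdj (G : SimpleGraph V) (A B : Finset V) (u v : V) : Prop :=
  G.Adj u v ∧ (u ∈ A ∧ v ∈ B ∨ u ∈ B ∧ v ∈ A)

theorem CrossAdj.symm {A B : Finset V} {u v : V} (h : CrossAdj G A B u v) :
    CrossAdj G A B v u :=
  ⟨h.1.symm, h.2.symm.imp And.symm And.symm⟩

theorem CrossAdj.swap {A B : Finset V} {u v : V} (h : CrossAdj G A B u v) :
    CrossAdj G B A u v :=
  ⟨h.1, h.2.symm⟩

variable [DecidableEq V]

theorem card_toFinset_inter_le {A B : Finset V} (hAB : Disjoint A B) :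
    ∀ l : List V, l.IsChain (CrossAdj G A B) → 2 * (l.toFinset ∩ A).card ≤ l.length + 1
  | [], _ => by simp
  | [x], _ => by
    have : (([x] : List V).toFinset ∩ A).card ≤ ([x] : List V).toFinset.card :=
      Finset.card_le_card Finset.inter_subset_left
    simp at this ⊢
    omega
  | x :: y :: l, h => by
    rw [List.isChain_cons_cons] at h
    have ih := card_toFinset_inter_le hAB l h.2.tail
    have hsub : ∃ z, (x :: y :: l).toFinset ∩ A ⊆ insert z (l.toFinset ∩ A) := by
      rcases h.1.2 with ⟨-, hy⟩ | ⟨hx, -⟩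
      · refine ⟨x, fun v hv => ?_⟩
        have := Finset.disjoint_right.1 hAB hy
        simp only [Finset.mem_inter, List.mem_toFinset, List.mem_cons, Finset.mem_insert] at hv ⊢
        rcases hv with ⟨rfl | rfl | hv, hA⟩ <;> tauto
      · refine ⟨y, fun v hv => ?_⟩
        have := Finset.disjoint_right.1 hAB hx
        simp only [Finset.mem_inter, List.mem_toFinset, List.mem_cons, Finset.mem_insert] at hv ⊢
        rcases hv with ⟨rfl | rfl | hv, hA⟩ <;> tauto
    obtain ⟨z, hz⟩ := hsub
    have := (Finset.card_le_card hz).trans (Finset.card_insert_le _ _)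
    simp only [List.length_cons]
    omega

/-- A state of depth-first search in the pair `(A, B)` after `k` steps: `D` is the set of finished
vertices, `l` is the current path, and no edge runs between `D` and the unvisited vertices. Moving a
vertex onto the path and then off it are two steps. -/
structure SearchState (G : SimpleGraph V) (A B : Finset V) (q k : ℕ) (D : Finset V)
    (l : List V) : Prop where
  nodup : l.Nodup
  chain : l.IsChain (CrossAdj G A B)
  finished_subset : D ⊆ A ∪ B
  path_mem : ∀ v ∈ l, v ∈ A ∪ B ∧ v ∉ D
  count : 2 * D.card + l.length = k
  left_lt : (D ∩ A).card < q
  right_lt : (D ∩ B).card < q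
  no_edge : ∀ d ∈ D, ∀ v ∈ A ∪ B, v ∉ D → v ∉ l → ¬ CrossAdj G A B d v

/-- If the current path is short, then there are many unvisited vertices, so fewer than `q` vertices
of either side can be finished. -/
theorem card_insert_inter_lt {A B D : Finset V} {q N : ℕ} {x : V} {l : List V}
    (hAB : Disjoint A B) (hJ : Joined G q A B) (hB : N + 2 * q ≤ B.card)
    (hlen : (x :: l).length ≤ 2 * N + 1) (hch : (x :: l).IsChain (CrossAdj G A B))
    (hD : (D ∩ B).card < q)
    (hno : ∀ d ∈ insert x D, ∀ v ∈ A ∪ B, v ∉ insert x D → v ∉ l → ¬ CrossAdj G A B d v) :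
    (insert x D ∩ A).card < q := by
  by_contra! hq
  have h1 : (insert x D ∩ B).card ≤ (D ∩ B).card + 1 := by
    refine (Finset.card_le_card (t := insert x (D ∩ B)) ?_).trans (Finset.card_insert_le _ _)
    intro v hv
    simp only [Finset.mem_inter, Finset.mem_insert] at hv ⊢
    tauto
  have h2 := card_toFinset_inter_le (A := B) (B := A) hAB.symm l
    (hch.tail.imp fun _ _ h => h.swap)
  have h3 : B.card ≤ (B \ (insert x D ∪ l.toFinset)).card + (insert x D ∩ B).card +
      (l.toFinset ∩ B).card := by
    rw [← Finset.card_sdiff_add_card_inter B (insert x D ∪ l.toFinset), add_assoc]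
    refine Nat.add_le_add_left ?_ _
    rw [Finset.inter_comm, Finset.union_inter_distrib_right]
    exact Finset.card_union_le _ _
  rw [List.length_cons] at hlen
  obtain ⟨d, hd, v, hv, e⟩ := hJ (insert x D ∩ A) Finset.inter_subset_right
    (B \ (insert x D ∪ l.toFinset)) Finset.sdiff_subset hq (by omega)
  simp only [Finset.mem_inter, Finset.mem_sdiff, Finset.mem_union, List.mem_toFinset, not_or]
    at hd hv
  exact hno d hd.1 v (Finset.mem_union_right _ hv.1) hv.2.1 hv.2.2 ⟨e, .inl ⟨hd.2, hv.1⟩⟩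

theorem SearchState.step {A B : Finset V} {q N k : ℕ} (hAB : Disjoint A B)
    (hJ : Joined G q A B) (hA : N + 2 * q ≤ A.card) (hB : N + 2 * q ≤ B.card)
    {D : Finset V} {l : List V} (h : SearchState G A B q k D l) (hl : l.length ≤ 2 * N + 1) :
    ∃ D' l', SearchState G A B q (k + 1) D' l' := by
  match l, h, hl with
  | [], h, _ => ?_
  | x :: l, h, hl => ?_
  · have hlt := h.left_lt
    have := Finset.card_sdiff_add_card_inter A D
    rw [Finset.inter_comm] at this
    obtain ⟨u, hu⟩ : (A \ D).Nonempty := Finset.card_pos.1 (by omega)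
    rw [Finset.mem_sdiff] at hu
    refine ⟨D, [u], by simp, by simp, h.finished_subset, ?_, ?_, hlt, h.right_lt, ?_⟩
    · intro v hv
      rw [List.mem_singleton] at hv
      subst hv
      exact ⟨Finset.mem_union_left _ hu.1, hu.2⟩
    · have := h.count
      simpa using this
    · intro d hd v hv hvD _
      exact h.no_edge d hd v hv hvD (by simp)
  · by_cases hext : ∃ v ∈ A ∪ B, v ∉ D ∧ v ∉ x :: l ∧ CrossAdj G A B x v
    · obtain ⟨v, hv, hvD, hvl, e⟩ := hext
      refine ⟨D, v :: x :: l, ?_, ?_, h.finished_subset, ?_, ?_, h.left_lt, h.right_lt, ?_⟩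
      · exact List.nodup_cons.2 ⟨hvl, h.nodup⟩
      · exact List.isChain_cons_cons.2 ⟨e.symm, h.chain⟩
      · intro w hw
        rcases List.mem_cons.1 hw with rfl | hw
        · exact ⟨hv, hvD⟩
        · exact h.path_mem w hw
      · have := h.count
        simp only [List.length_cons] at this ⊢
        omega
      · intro d hd w hw hwD hwl
        exact h.no_edge d hd w hw hwD fun h' => hwl (List.mem_cons_of_mem _ h')
    · have hxl := List.nodup_cons.1 h.nodup
      have hx := h.path_mem x (by simp)
      have hno : ∀ d ∈ insert x D, ∀ v ∈ A ∪ B, v ∉ insert x D → v ∉ l →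
          ¬ CrossAdj G A B d v := by
        intro d hd v hv hvD hvl e
        rw [Finset.mem_insert, not_or] at hvD
        have hvl' : v ∉ x :: l := by
          rw [List.mem_cons, not_or]
          exact ⟨hvD.1, hvl⟩
        rcases Finset.mem_insert.1 hd with rfl | hd
        · exact hext ⟨v, hv, hvD.2, hvl', e⟩
        · exact h.no_edge d hd v hv hvD.2 hvl' e
      refine ⟨insert x D, l, hxl.2, h.chain.tail, ?_, ?_, ?_, ?_, ?_, hno⟩
      · exact Finset.insert_subset hx.1 h.finished_subset
      · intro v hv
        refine ⟨(h.path_mem v (by simp [hv])).1, ?_⟩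
        rw [Finset.mem_insert, not_or]
        exact ⟨fun hvx => hxl.1 (hvx ▸ hv), (h.path_mem v (by simp [hv])).2⟩
      · have := h.count
        rw [Finset.card_insert_of_notMem hx.2]
        simp only [List.length_cons] at this
        omega
      · exact card_insert_inter_lt hAB hJ hB hl h.chain h.right_lt hno
      · refine card_insert_inter_lt hAB.symm hJ.symm hA hl (h.chain.imp fun _ _ h => h.swap)
          h.left_lt ?_
        intro d hd v hv hvD hvl e
        exact hno d hd v (by rwa [Finset.union_comm]) hvD hvl e.swap

/-- Depth-first search finds an alternating path that misses only about `2 * q` vertices of either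
side: otherwise the search could go on forever. -/
theorem exists_long_chain {A B : Finset V} {q N : ℕ} (hq : 0 < q) (hAB : Disjoint A B)
    (hJ : Joined G q A B) (hA : N + 2 * q ≤ A.card) (hB : N + 2 * q ≤ B.card) :
    ∃ l : List V, l.Nodup ∧ l.IsChain (CrossAdj G A B) ∧ 2 * N + 2 ≤ l.length := by
  by_contra! hcon
  have hall : ∀ k, ∃ D l, SearchState G A B q k D l := by
    intro k
    induction k with
    | zero => exact ⟨∅, [], by simp, by simp, by simp, by simp, by simp, by simpa, by simpa, by simp⟩
    | succ k ih =>
      obtain ⟨D, l, h⟩ := ih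
      have := hcon l h.nodup h.chain
      exact h.step hAB hJ hA hB (by omega)
  obtain ⟨D, l, h⟩ := hall (4 * q + 2 * N + 2)
  have h1 := hcon l h.nodup h.chain
  have h2 : D.card ≤ (D ∩ A).card + (D ∩ B).card := by
    rw [← Finset.inter_eq_left.2 h.finished_subset, Finset.inter_union_distrib_left]
    refine (Finset.card_union_le _ _).trans (Nat.add_le_add ?_ ?_) <;>
    · refine Finset.card_le_card fun v hv => ?_
      simp only [Finset.mem_inter, Finset.mem_union] at hv ⊢
      tauto
  have := h.count
  have := h.left_lt
  have := h.right_lt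
  omega

omit [DecidableEq V] in
/-- An alternating path with `2 * N` vertices that starts in `A`, as a sequence. -/
theorem exists_alternating_seq {A B : Finset V} {q N : ℕ} (hq : 0 < q) (hAB : Disjoint A B)
    (hJ : Joined G q A B) (hA : N + 2 * q ≤ A.card) (hB : N + 2 * q ≤ B.card) :
    ∃ p : ℕ → V, Set.InjOn p (Set.Iio (2 * N)) ∧
      (∀ i, i + 1 < 2 * N → G.Adj (p i) (p (i + 1))) ∧
      ∀ i < 2 * N, (i % 2 = 0 → p i ∈ A) ∧ (i % 2 = 1 → p i ∈ B) := by
  classical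
  obtain ⟨l, hnd, hch, hlen⟩ := exists_long_chain hq hAB hJ hA hB
  rw [List.isChain_iff_getElem] at hch
  obtain ⟨v₀, -⟩ : A.Nonempty := Finset.card_pos.1 (by omega)
  -- skip the first vertex if it lies in `B`
  obtain ⟨o, ho, hoA⟩ : ∃ o, ∃ h : o ≤ 1, l[o]'(by omega) ∈ A := by
    rcases (hch 0 (by omega)).2 with h | h
    · exact ⟨0, by omega, h.1⟩
    · exact ⟨1, by omega, h.2⟩
  have hget : ∀ i, i < 2 * N + 1 → ∃ h : o + i < l.length, l.getD (o + i) v₀ = l[o + i] := by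
    intro i hi
    refine ⟨by omega, ?_⟩
    rw [List.getD_eq_getElem]
  have hmem : ∀ i < 2 * N, (i % 2 = 0 → l.getD (o + i) v₀ ∈ A) ∧
      (i % 2 = 1 → l.getD (o + i) v₀ ∈ B) := by
    intro i
    induction i with
    | zero =>
      intro hi
      obtain ⟨h, e⟩ := hget 0 (by omega)
      rw [e]
      exact ⟨fun _ => hoA, by omega⟩
    | succ i ih =>
      intro hi
      have ih := ih (by omega)
      obtain ⟨h, e⟩ := hget i (by omega)
      obtain ⟨h', e'⟩ := hget (i + 1) (by omega)
      have hadj := hch (o + i) (by omega)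
      rw [e] at ih
      rw [e']
      have hd := @Finset.disjoint_left _ A B |>.1 hAB
      rcases hadj.2 with ⟨h1, h2⟩ | ⟨h1, h2⟩
      · have : i % 2 = 0 := by
          by_contra hne
          exact hd h1 (ih.2 (by omega))
        exact ⟨by omega, fun _ => h2⟩
      · have : i % 2 = 1 := by
          by_contra hne
          exact hd (ih.1 (by omega)) h1
        exact ⟨fun _ => h2, by omega⟩
  refine ⟨fun i => l.getD (o + i) v₀, ?_, ?_, hmem⟩
  · intro i hi j hj hij
    rw [Set.mem_Iio] at hi hj
    obtain ⟨h, e⟩ := hget i (by omega)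
    obtain ⟨h', e'⟩ := hget j (by omega)
    simp only [e, e'] at hij
    rw [hnd.getElem_inj_iff] at hij
    omega
  · intro i hi
    obtain ⟨h, e⟩ := hget i (by omega)
    obtain ⟨h', e'⟩ := hget (i + 1) (by omega)
    simp only [e, e']
    exact (hch (o + i) (by omega)).1

/-! ### Linking alternating paths of consecutive pairs -/

/-- A path through the pairs `(W 0, W 1)`, `(W 2, W 3)`, …, with exactly `2 * N` vertices per pair:
apart from the last `2 * q` of them, the vertices with indices in `[2 * N * j, 2 * N * (j + 1))`
alternate between `W (2 * j)` and `W (2 * j + 1)`. Consecutive alternating paths are linked by an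
edge between the last vertices of one and the first vertices of the next, and then cut to the exact
length. In the last block the sides of all vertices are known, which carries the induction. -/
theorem exists_linked_seq {W : ℕ → Finset V} {q N : ℕ} (hq : 0 < q) (hqN : q ≤ N)
    (hJ : ∀ i, Joined G q (W i) (W (i + 1))) (hW : Pairwise (Function.onFun Disjoint W)) (r : ℕ)
    (hcard : ∀ i < 2 * (r + 1), N + 4 * q ≤ (W i).card) :
    ∃ p : ℕ → V, Set.InjOn p (Set.Iio (2 * N * (r + 1))) ∧
      (∀ i, i + 1 < 2 * N * (r + 1) → G.Adj (p i) (p (i + 1))) ∧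
      (∀ i < 2 * N * (r + 1), ∃ l < 2 * (r + 1), p i ∈ W l) ∧
      (∀ i, 2 * N * r ≤ i → i < 2 * N * (r + 1) → p i ∈ W (2 * r + i % 2)) ∧
      (∀ j ≤ r, ∀ i, 2 * N * j ≤ i → i + 2 * q < 2 * N * (j + 1) → p i ∈ W (2 * j + i % 2)) := by
  induction r with
  | zero =>
    obtain ⟨p, h1, h2, h3⟩ := exists_alternating_seq (N := N) hq (hW (by simp : (0 : ℕ) ≠ 1))
      (hJ 0) (by have := hcard 0 (by omega); omega) (by have := hcard 1 (by omega); omega)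
    have h4 : ∀ i < 2 * N, p i ∈ W (2 * 0 + i % 2) := by
      intro i hi
      rcases Nat.mod_two_eq_zero_or_one i with h | h
      · rw [h]; exact (h3 i hi).1 h
      · rw [h]; exact (h3 i hi).2 h
    simp only [zero_add, mul_one]
    refine ⟨p, h1, h2, fun i hi => ⟨_, by omega, h4 i hi⟩, fun i _ hi => h4 i hi, ?_⟩
    intro j hj i _ hi
    obtain rfl : j = 0 := by omega
    exact h4 i (by omega)
  | succ r ih =>
    obtain ⟨p, pinj, padj, pmem, plast, pblock⟩ := ih fun i hi => hcard i (by omega)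
    obtain ⟨p', inj', adj', mem'⟩ := exists_alternating_seq (N := N + 2 * q) hq
      (hW (show 2 * (r + 1) ≠ 2 * (r + 1) + 1 by omega)) (hJ _)
      (by have := hcard (2 * (r + 1)) (by omega); omega)
      (by have := hcard (2 * (r + 1) + 1) (by omega); omega)
    have hmem' : ∀ i < 2 * (N + 2 * q), p' i ∈ W (2 * (r + 1) + i % 2) := by
      intro i hi
      rcases Nat.mod_two_eq_zero_or_one i with h | h
      · rw [h]; exact (mem' i hi).1 h
      · rw [h]; exact (mem' i hi).2 h
    have eL : 2 * N * (r + 1) = 2 * N * r + 2 * N := by ring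
    have eL' : 2 * N * (r + 1 + 1) = 2 * N * (r + 1) + 2 * N := by ring
    have ev : (2 * N * (r + 1)) % 2 = 0 := by rw [mul_assoc]; omega
    set L := 2 * N * (r + 1) with hL
    rw [Set.InjOn] at pinj inj'
    simp only [Set.mem_Iio] at pinj inj'
    -- the linking edge
    obtain ⟨x, hx, y, hy, e⟩ := hJ (2 * r + 1)
      ((Finset.range q).image fun g => p (L - 2 * q + 2 * g + 1)) (by
        intro v hv
        obtain ⟨g, hg, rfl⟩ := Finset.mem_image.1 hv
        rw [Finset.mem_range] at hg
        have := plast (L - 2 * q + 2 * g + 1) (by omega) (by omega)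
        rwa [show (L - 2 * q + 2 * g + 1) % 2 = 1 by omega] at this)
      ((Finset.range q).image fun g => p' (2 * g)) (by
        intro v hv
        obtain ⟨g, hg, rfl⟩ := Finset.mem_image.1 hv
        rw [Finset.mem_range] at hg
        have := hmem' (2 * g) (by omega)
        rwa [show 2 * g % 2 = 0 by omega] at this)
      (by
        rw [Finset.card_image_of_injOn, Finset.card_range]
        intro g hg g' hg' h
        rw [Finset.coe_range, Set.mem_Iio] at hg hg'
        have := pinj (by omega) (by omega) h
        omega)
      (by
        rw [Finset.card_image_of_injOn, Finset.card_range]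
        intro g hg g' hg' h
        rw [Finset.coe_range, Set.mem_Iio] at hg hg'
        have := inj' (by omega) (by omega) h
        omega)
    obtain ⟨g, hg, rfl⟩ := Finset.mem_image.1 hx
    obtain ⟨g', hg', rfl⟩ := Finset.mem_image.1 hy
    rw [Finset.mem_range] at hg hg'
    set a := L - 2 * q + 2 * g + 1 with ha
    have hnew : ∀ i, a < i → i < L + 2 * N →
        p' (2 * g' + (i - (a + 1))) ∈ W (2 * (r + 1) + i % 2) := by
      intro i hi hi'
      have := hmem' (2 * g' + (i - (a + 1))) (by omega)
      rwa [show (2 * g' + (i - (a + 1))) % 2 = i % 2 by omega] at this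
    have hcross : ∀ i j, i ≤ a → a < j → j < L + 2 * N →
        p i ≠ p' (2 * g' + (j - (a + 1))) := by
      intro i j hi hj hj' h
      obtain ⟨l, hl, hm⟩ := pmem i (by omega)
      exact Finset.disjoint_left.1 (hW (show l ≠ 2 * (r + 1) + j % 2 by omega)) hm
        (h ▸ hnew j hj hj')
    rw [eL']
    refine ⟨fun i => if i ≤ a then p i else p' (2 * g' + (i - (a + 1))), ?_, ?_, ?_, ?_, ?_⟩
    · intro i hi j hj hij
      rw [Set.mem_Iio] at hi hj
      simp only at hij
      split_ifs at hij with h1 h2 h2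
      · exact pinj (by omega) (by omega) hij
      · exact absurd hij (hcross i j h1 (by omega) hj)
      · exact absurd hij.symm (hcross j i h2 (by omega) hi)
      · have := inj' (by omega) (by omega) hij
        omega
    · intro i hi
      beta_reduce
      rcases lt_trichotomy i a with h | h | h
      · rw [if_pos (by omega), if_pos (by omega)]
        exact padj i (by omega)
      · rw [if_pos (by omega), if_neg (by omega), h, show a + 1 - (a + 1) = 0 by omega]
        exact e
      · rw [if_neg (by omega), if_neg (by omega),
          show 2 * g' + (i + 1 - (a + 1)) = 2 * g' + (i - (a + 1)) + 1 by omega]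
        exact adj' _ (by omega)
    · intro i hi
      simp only
      split_ifs with h
      · obtain ⟨l, hl, hm⟩ := pmem i (by omega)
        exact ⟨l, by omega, hm⟩
      · exact ⟨_, by omega, hnew i (by omega) hi⟩
    · intro i hi hi'
      beta_reduce
      rw [if_neg (by omega)]
      exact hnew i (by omega) hi'
    · intro j hj i hi hi'
      beta_reduce
      rcases Nat.lt_or_ge r j with h | h
      · obtain rfl : j = r + 1 := by omega
        rw [if_neg (by omega)]
        exact hnew i (by omega) (by omega)
      · have : 2 * N * (j + 1) ≤ L := Nat.mul_le_mul_left _ (by omega)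
        rw [if_pos (by omega)]
        exact pblock j h i hi hi'

end

section

variable {V : Type*} {G : SimpleGraph V}

/-! ### Closing a path to a cycle of prescribed length -/

/-- Pairwise disjoint sets `W i`, `R i`, `Z i` inside the clusters `C i`, in which the three kinds of
pieces of a cycle are found: a long path in the `W i`, two trees growing from its ends in the `R i`,
and a connection between the trees with one vertex in each of the first few `Z i`. The clusters need
not be disjoint. -/
structure Layout (C W R Z : ℕ → Finset V) : Prop where
  W_subset : ∀ i, W i ⊆ C i
  R_subset : ∀ i, R i ⊆ C i
  Z_subset : ∀ i, Z i ⊆ C i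
  W_disjoint : Pairwise (Function.onFun Disjoint W)
  R_disjoint : Pairwise (Function.onFun Disjoint R)
  Z_disjoint : Pairwise (Function.onFun Disjoint Z)
  W_R : ∀ i j, Disjoint (W i) (R j)
  W_Z : ∀ i j, Disjoint (W i) (Z j)
  R_Z : ∀ i j, Disjoint (R i) (Z j)

/-- The conclusion of `exists_twoTrees_odd`: trees of depth `h` with `q` vertices in their last
levels grow in every pair that expands in both directions. -/
def TreesGrow (G : SimpleGraph V) (a D q h : ℕ) [DecidableEq V] : Prop :=
  ∀ {A B : Finset V} {x y : V}, Disjoint A B → Expands G a D A B → Expands G a D B A →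
    x ∈ A → y ∈ B → ∃ u, TwoTrees G x y h q u B A

variable [DecidableEq V]

/-- The reachable set is carried from `C 1` through `Z 0`, `Z 1`, …, `Z (w - 1)`, after which it is
joined to `C w`. -/
theorem exists_reach_chain {C Z : ℕ → Finset V} {q : ℕ} (hJ : ∀ i, Joined G q (C i) (C (i + 1)))
    (hZC : ∀ i, Z i ⊆ C i) (hZ : Pairwise (Function.onFun Disjoint Z)) {x : V} {T X : Finset V}
    {l : ℕ} (hX : X ⊆ C 1) (hXq : q ≤ X.card) (hR : Reach G x T l X)
    (hTZ : ∀ i, Disjoint T (Z i)) (w : ℕ) (hcard : ∀ i < w, 2 * q ≤ (Z i).card) :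
    ∃ X', q ≤ X'.card ∧ Joined G q X' (C w) ∧
      Reach G x (T ∪ (Finset.range w).biUnion Z) (l + w) X' := by
  induction w with
  | zero =>
    refine ⟨X, hXq, (hJ 0).symm.mono hX (Finset.Subset.refl _), ?_⟩
    simpa using hR
  | succ w ih =>
    obtain ⟨X', h1, h2, h3⟩ := ih fun i hi => hcard i (by omega)
    have h4 := (h2.mono (Finset.Subset.refl _) (hZC w)).card_lt_card_nbrs_add
      (Finset.Subset.refl _) h1
    have h5 := hcard w (by omega)
    refine ⟨nbrs G X' (Z w), by omega, (hJ w).mono (nbrs_subset.trans (hZC w))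
      (Finset.Subset.refl _), ?_⟩
    have hd : Disjoint (T ∪ (Finset.range w).biUnion Z) (nbrs G X' (Z w)) := by
      refine Finset.disjoint_of_subset_right nbrs_subset ?_
      rw [Finset.disjoint_union_left, Finset.disjoint_biUnion_left]
      refine ⟨hTZ w, fun i hi => hZ ?_⟩
      rw [Finset.mem_range] at hi
      omega
    have h6 := h3.step (fun v hv => (mem_nbrs.1 hv).2) hd
    intro v hv
    refine (h6 v hv).mono ?_
    rw [Finset.union_assoc]
    refine Finset.union_subset_union_right (Finset.union_subset ?_ ?_)
    · exact Finset.biUnion_subset_biUnion_of_subset_left _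
        (Finset.range_subset_range.2 (by omega))
    · exact nbrs_subset.trans (Finset.subset_biUnion_of_mem Z (by simp))

/-- Among `2 * q` candidate pairs of vertices, one has a neighbour in `A` for its first vertex and a
neighbour in `B` for its second. -/
theorem exists_adj_pair {q : ℕ} {A B C D : Finset V} {f g : ℕ → V}
    (hA : Joined G q A C) (hB : Joined G q B D)
    (hAq : q ≤ A.card) (hBq : q ≤ B.card) (hf : ∀ i < 2 * q, f i ∈ C) (hg : ∀ i < 2 * q, g i ∈ D)
    (fi : Set.InjOn f (Set.Iio (2 * q))) (gi : Set.InjOn g (Set.Iio (2 * q))) :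
    ∃ i < 2 * q, (∃ x ∈ A, G.Adj x (f i)) ∧ ∃ y ∈ B, G.Adj y (g i) := by
  classical
  have key : ∀ {A C : Finset V} {f : ℕ → V}, Joined G q A C → q ≤ A.card →
      (∀ i < 2 * q, f i ∈ C) → Set.InjOn f (Set.Iio (2 * q)) →
      ((Finset.range (2 * q)).filter fun i => ¬ ∃ x ∈ A, G.Adj x (f i)).card < q := by
    intro A C f hA hAq hf fi
    by_contra hcon
    rw [not_lt] at hcon
    obtain ⟨x, hx, y, hy, e⟩ := hA A (Finset.Subset.refl _)
      (((Finset.range (2 * q)).filter fun i => ¬ ∃ x ∈ A, G.Adj x (f i)).image f)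
      (by
        intro v hv
        obtain ⟨i, hi, rfl⟩ := Finset.mem_image.1 hv
        exact hf i (by simpa using (Finset.mem_filter.1 hi).1)) hAq (by
        rwa [Finset.card_image_of_injOn]
        exact fi.mono fun i hi => by simpa using (Finset.mem_filter.1 hi).1)
    obtain ⟨i, hi, rfl⟩ := Finset.mem_image.1 hy
    exact (Finset.mem_filter.1 hi).2 ⟨x, hx, e⟩
  have h1 := key hA hAq hf fi
  have h2 := key hB hBq hg gi
  by_contra! hcon
  have h3 : Finset.range (2 * q) ⊆
      ((Finset.range (2 * q)).filter fun i => ¬ ∃ x ∈ A, G.Adj x (f i)) ∪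
        ((Finset.range (2 * q)).filter fun i => ¬ ∃ x ∈ B, G.Adj x (g i)) := by
    intro i hi
    rw [Finset.mem_union, Finset.mem_filter, Finset.mem_filter]
    by_cases h : ∃ x ∈ A, G.Adj x (f i)
    · refine .inr ⟨hi, ?_⟩
      rintro ⟨y, hy, e⟩
      exact hcon i (by simpa using hi) h y hy e
    · exact .inl ⟨hi, h⟩
  have := (Finset.card_le_card h3).trans (Finset.card_union_le _ _)
  rw [Finset.card_range] at this
  omega

/-- A segment of length `s` of a path, two trees of depth `h` growing from neighbours of its ends,
and a chain through `Z 0`, …, `Z (w - 1)` between the trees form a cycle. There are `2 * q` candidates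
for the segment, and one of them has ends with neighbours in the expanding parts of the reserved
sets. -/
theorem Layout.hasCycleOfLength {C W R Z : ℕ → Finset V} (hL : Layout C W R Z) {q a D h : ℕ}
    (hq : 0 < q) (hJ : ∀ i, Joined G q (C i) (C (i + 1))) (htree : TreesGrow G a D q h) {j w : ℕ}
    (hR : ∀ i < 2 * (j + 1), D * (q + a) + 2 * q ≤ (R i).card)
    (hw : C w = C (2 * j)) (hZ : ∀ i < w, 2 * q ≤ (Z i).card)
    {p : ℕ → V} {L : ℕ} (hinj : Set.InjOn p (Set.Iio L))
    (hadj : ∀ i, i + 1 < L → G.Adj (p i) (p (i + 1))) (hmem : ∀ i < L, ∃ l, p i ∈ W l)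
    {lo s : ℕ} (hlo : lo + 2 * (2 * q - 1) + s < L) (h0 : ∀ g < 2 * q, p (lo + 2 * g) ∈ W 1)
    (hs : ∀ g < 2 * q, p (lo + 2 * g + s) ∈ W (2 * j)) :
    HasCycleOfLength G (s + 2 * h + w + 3) := by
  have hJR : ∀ i, Joined G q (R i) (R (i + 1)) := fun i =>
    (hJ i).mono (hL.R_subset _) (hL.R_subset _)
  -- the expanding part of each reserved pair
  have hE : ∀ i ≤ j, ∃ A ⊆ R (2 * i), ∃ B ⊆ R (2 * i + 1), q ≤ A.card ∧ q ≤ B.card ∧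
      Expands G a D A B ∧ Expands G a D B A := fun i hi =>
    (hJR (2 * i)).exists_expands hq (hR _ (by omega)) (hR _ (by omega))
  choose! A hA B hB hAq hBq eA eB using hE
  have hdis : ∀ i ≤ j, Disjoint (A i) (B i) := fun i hi =>
    Finset.disjoint_of_subset_left (hA i hi) (Finset.disjoint_of_subset_right (hB i hi)
      (hL.R_disjoint (by omega)))
  obtain ⟨g, hg, ⟨x, hx, ex⟩, ⟨y, hy, ey⟩⟩ := exists_adj_pair (A := A 0) (B := B j) (C := W 1)
    (D := W (2 * j))
    ((hJ 0).mono ((hA 0 (by omega)).trans (hL.R_subset _)) (hL.W_subset _))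
    ((hJ (2 * j)).symm.mono ((hB j le_rfl).trans (hL.R_subset _)) (hL.W_subset _))
    (hAq 0 (by omega)) (hBq j le_rfl) h0 hs
    (by
      intro i hi i' hi' hii
      rw [Set.mem_Iio] at hi hi'
      have := hinj (Set.mem_Iio.2 (by omega)) (Set.mem_Iio.2 (by omega)) hii
      omega)
    (by
      intro i hi i' hi' hii
      rw [Set.mem_Iio] at hi hi'
      have := hinj (Set.mem_Iio.2 (by omega)) (Set.mem_Iio.2 (by omega)) hii
      omega)
  -- if `j = 0`, both trees grow in one pair and must be grown together
  obtain ⟨X, Y, S, T, hX, hY, hS, hT, hST, cX, cY, rX, rY⟩ : ∃ X Y S T : Finset V, X ⊆ R 1 ∧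
      Y ⊆ R (2 * j) ∧ S ⊆ R 0 ∪ R 1 ∧ T ⊆ R (2 * j) ∪ R (2 * j + 1) ∧ Disjoint S T ∧
      X.card = q ∧ Y.card = q ∧ Reach G x S h X ∧ Reach G y T h Y := by
    have hsub : ∀ i ≤ j, B i ∪ A i ⊆ R (2 * i) ∪ R (2 * i + 1) := fun i hi => by
      rw [Finset.union_comm]
      exact Finset.union_subset_union (hA i hi) (hB i hi)
    rcases Nat.eq_zero_or_pos j with rfl | hj
    · obtain ⟨u, X, hX, Y, hY, S, T, hS, hT, hST, cX, cY, -, -, rX, rY⟩ :=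
        htree (hdis 0 le_rfl) (eA 0 le_rfl) (eB 0 le_rfl) hx hy
      exact ⟨X, Y, S, T, hX.trans (hB 0 le_rfl), hY.trans (hA 0 le_rfl), hS.trans (hsub 0 le_rfl),
        hT.trans (hsub 0 le_rfl), hST, cX, cY, rX, rY⟩
    · obtain ⟨y₀, hy₀⟩ : (B 0).Nonempty := Finset.card_pos.1 (by have := hBq 0 (by omega); omega)
      obtain ⟨x₀, hx₀⟩ : (A j).Nonempty := Finset.card_pos.1 (by have := hAq j le_rfl; omega)
      obtain ⟨u, X, hX, -, -, S, -, hS, -, -, cX, -, -, -, rX, -⟩ :=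
        htree (hdis 0 (by omega)) (eA 0 (by omega)) (eB 0 (by omega)) hx hy₀
      obtain ⟨u, -, -, Y, hY, -, T, -, hT, -, -, cY, -, -, -, rY⟩ :=
        htree (hdis j le_rfl) (eA j le_rfl) (eB j le_rfl) hx₀ hy
      have hS' := hS.trans (hsub 0 (by omega))
      have hT' := hT.trans (hsub j le_rfl)
      refine ⟨X, Y, S, T, hX.trans (hB 0 (by omega)), hY.trans (hA j le_rfl), hS', hT', ?_, cX, cY,
        rX, rY⟩
      refine Finset.disjoint_of_subset_left hS' (Finset.disjoint_of_subset_right hT' ?_)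
      simp only [Finset.disjoint_union_left, Finset.disjoint_union_right]
      refine ⟨⟨hL.R_disjoint ?_, hL.R_disjoint ?_⟩, hL.R_disjoint ?_, hL.R_disjoint ?_⟩ <;> omega
  have hSmem : ∀ v ∈ S, ∃ l, v ∈ R l := fun v hv => by
    rcases Finset.mem_union.1 (hS hv) with h | h <;> exact ⟨_, h⟩
  have hTmem : ∀ v ∈ T, ∃ l, v ∈ R l := fun v hv => by
    rcases Finset.mem_union.1 (hT hv) with h | h <;> exact ⟨_, h⟩
  obtain ⟨X', hX'q, hX'J, hX'R⟩ := exists_reach_chain hJ hL.Z_subset hL.Z_disjoint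
    (hX.trans (hL.R_subset 1)) cX.ge rX (by
      intro i
      rw [Finset.disjoint_left]
      intro v hv
      obtain ⟨l, hl⟩ := hSmem v hv
      exact Finset.disjoint_left.1 (hL.R_Z l i) hl) w hZ
  obtain ⟨v, hv, v', hv', e⟩ := hX'J X' (Finset.Subset.refl _) Y
    (by rw [hw]; exact hY.trans (hL.R_subset _)) hX'q cY.ge
  have hseg := PathIn.of_seq hinj hadj (lo + 2 * g) s (by omega)
  have hsegmem : ∀ v ∈ (Finset.Icc (lo + 2 * g) (lo + 2 * g + s)).image p, ∃ l, v ∈ W l := by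
    intro v hv
    obtain ⟨i, hi, rfl⟩ := Finset.mem_image.1 hv
    rw [Finset.mem_Icc] at hi
    exact hmem i (by omega)
  have hP := (hseg.join ey.symm (rY v' hv') (by
    rw [Finset.disjoint_left]
    intro u hu hu'
    obtain ⟨l, hl⟩ := hsegmem u hu
    obtain ⟨l', hl'⟩ := hTmem u hu'
    exact Finset.disjoint_left.1 (hL.W_R l l') hl hl')).join e.symm (hX'R v hv).symm (by
    rw [Finset.disjoint_left]
    intro u hu hu'
    rw [Finset.mem_union, Finset.mem_biUnion] at hu'
    rcases Finset.mem_union.1 hu with hu | hu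
    · obtain ⟨l, hl⟩ := hsegmem u hu
      rcases hu' with hu' | ⟨l', -, hl'⟩
      · obtain ⟨l', hl'⟩ := hSmem u hu'
        exact Finset.disjoint_left.1 (hL.W_R l l') hl hl'
      · exact Finset.disjoint_left.1 (hL.W_Z l l') hl hl'
    · rcases hu' with hu' | ⟨l', -, hl'⟩
      · exact Finset.disjoint_left.1 hST hu' hu
      · obtain ⟨l, hl⟩ := hTmem u hu
        exact Finset.disjoint_left.1 (hL.R_Z l l') hl hl')
  have := hP.hasCycleOfLength ex (by omega)
  rwa [show s + 1 + h + 1 + (h + w) + 1 = s + 2 * h + w + 3 by omega] at this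

/-- Cycles of all lengths of the parity of `e`, from the shortest that the two trees allow up to
about the total size of the sets `W i`. The segment starts in the first pair and ends in pair `j`.
Its end must avoid the last `2 * q` indices of a block of `exists_linked_seq`, where the side of a
vertex is not known; the start is moved within the first block to achieve this. -/
theorem Layout.hasCycleOfLength_of_le {C W R Z : ℕ → Finset V} (hL : Layout C W R Z)
    {q a D h : ℕ} (hq : 0 < q) (hJ : ∀ i, Joined G q (C i) (C (i + 1)))
    (htree : TreesGrow G a D q h) {r e N : ℕ} (hN : r + 7 * q ≤ N)
    (hW : ∀ i < 2 * (r + 1), N + 4 * q ≤ (W i).card)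
    (hR : ∀ i < 2 * (r + 1), D * (q + a) + 2 * q ≤ (R i).card)
    (hZ : ∀ i < 2 * r + e, 2 * q ≤ (Z i).card) (hC : ∀ j ≤ r, C (2 * j + e) = C (2 * j)) {t : ℕ}
    (hpar : t % 2 = e % 2) (ht : 2 * h + 4 + e ≤ t) (ht' : t + 6 * q ≤ 2 * N * (r + 1)) :
    HasCycleOfLength G t := by
  obtain ⟨p, hinj, hadj, hmem, -, hblock⟩ := exists_linked_seq (N := N) hq (by omega)
    (fun i => (hJ i).mono (hL.W_subset _) (hL.W_subset _)) hL.W_disjoint r hW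
  have hmem' : ∀ i < 2 * N * (r + 1), ∃ l, p i ∈ W l := fun i hi =>
    (hmem i hi).imp fun _ h => h.2
  have hblock0 : ∀ i, i % 2 = 1 → i + 2 * q < 2 * N → p i ∈ W 1 := by
    intro i hi hi'
    have := hblock 0 (by omega) i (by omega) (by omega)
    rwa [hi] at this
  obtain ⟨T, hT⟩ : ∃ T, t = T + 2 * h + 3 + e := ⟨t - 2 * h - 3 - e, by omega⟩
  have hdm := Nat.div_add_mod T (2 * N)
  have hlt := Nat.mod_lt T (show 2 * N > 0 by omega)
  have hmm : T % (2 * N) % 2 = T % 2 := Nat.mod_mod_of_dvd T ⟨N, rfl⟩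
  set ρ := T % (2 * N) with hρ
  have hblock' : ∀ j ≤ r, ∀ i, i % 2 = 0 → 2 * N * j ≤ i → i + 2 * q < 2 * N * j + 2 * N →
      p i ∈ W (2 * j) := by
    intro j hj i hi h1 h2
    have := hblock j hj i h1 (by rwa [mul_add, mul_one])
    rwa [hi] at this
  have hmul : ∀ j ≤ r, 2 * N * j + 2 * N ≤ 2 * N * (r + 1) := by
    intro j hj
    calc 2 * N * j + 2 * N = 2 * N * (j + 1) := by ring
      _ ≤ _ := Nat.mul_le_mul_left _ (by omega)
  -- Deducting `2 * j` for the chain from the segment is offset by starting it `2 * j` later, so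
  -- `T` alone determines the block in which the segment ends.
  by_cases hcase : ρ + 6 * q ≤ 2 * N
  · have hjr : T / (2 * N) ≤ r := by
      have : T / (2 * N) < r + 1 := by
        rw [Nat.div_lt_iff_lt_mul (by omega), mul_comm]
        omega
      omega
    set j := T / (2 * N) with hj
    have hjT : 2 * j ≤ 2 * N * j := Nat.mul_le_mul_right _ (by omega)
    have hm := hmul j hjr
    have := hL.hasCycleOfLength hq hJ htree (j := j) (w := 2 * j + e)
      (fun i hi => hR i (by omega)) (hC j hjr) (fun i hi => hZ i (by omega)) hinj hadj hmem'
      (lo := 2 * j + 1) (s := T - 2 * j) (by omega)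
      (fun g hg => hblock0 _ (by omega) (by omega))
      (fun g hg => hblock' j hjr _ (by omega) (by omega) (by omega))
    rwa [show T - 2 * j + 2 * h + (2 * j + e) + 3 = t by omega] at this
  · -- too close to the end of its block: start later, so that the next block is just reached
    have hjr : T / (2 * N) + 1 ≤ r := by
      by_contra! hcon
      have : 2 * N * r ≤ 2 * N * (T / (2 * N)) := Nat.mul_le_mul_left _ (by omega)
      rw [mul_add, mul_one] at ht'
      omega
    set j := T / (2 * N) with hj
    have hm := hmul (j + 1) hjr
    have hsucc : 2 * N * (j + 1) = 2 * N * j + 2 * N := by ring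
    have := hL.hasCycleOfLength hq hJ htree (j := j + 1) (w := 2 * (j + 1) + e)
      (fun i hi => hR i (by omega)) (hC (j + 1) hjr) (fun i hi => hZ i (by omega)) hinj hadj hmem'
      (lo := 2 * (j + 1) + (2 * N - ρ)) (s := T - 2 * (j + 1)) (by omega)
      (fun g hg => hblock0 _ (by omega) (by omega))
      (fun g hg => hblock' (j + 1) hjr _ (by omega) (by omega) (by omega))
    rwa [show T - 2 * (j + 1) + 2 * h + (2 * (j + 1) + e) + 3 = t by omega] at this

/-- Short cycles need a path in the pair `(W 0, W 1)` only, so that almost everything can be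
reserved for the trees. -/
theorem Layout.hasCycleOfLength_of_le_single {C W R Z : ℕ → Finset V} (hL : Layout C W R Z)
    {q a D h : ℕ} (hq : 0 < q) (hJ : ∀ i, Joined G q (C i) (C (i + 1)))
    (htree : TreesGrow G a D q h) {e N : ℕ}
    (hW : ∀ i < 2, N + 2 * q ≤ (W i).card)
    (hR : ∀ i < 2, D * (q + a) + 2 * q ≤ (R i).card)
    (hZ : ∀ i < e, 2 * q ≤ (Z i).card) (hC : C e = C 0) {t : ℕ}
    (hpar : t % 2 = e % 2) (ht : 2 * h + 4 + e ≤ t) (ht' : t + 4 * q ≤ 2 * N) :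
    HasCycleOfLength G t := by
  obtain ⟨p, hinj, hadj, hmem⟩ := exists_alternating_seq (N := N) hq
    (hL.W_disjoint (show 0 ≠ 1 by omega)) ((hJ 0).mono (hL.W_subset _) (hL.W_subset _))
    (hW 0 (by omega)) (hW 1 (by omega))
  obtain ⟨T, hT⟩ : ∃ T, t = T + 2 * h + 3 + e := ⟨t - 2 * h - 3 - e, by omega⟩
  have := hL.hasCycleOfLength hq hJ htree (j := 0) (w := e)
    (fun i hi => hR i (by omega)) hC hZ hinj hadj
    (by
      intro i hi
      rcases Nat.mod_two_eq_zero_or_one i with h | h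
      · exact ⟨0, (hmem i hi).1 h⟩
      · exact ⟨1, (hmem i hi).2 h⟩)
    (lo := 1) (s := T) (by omega)
    (fun g hg => (hmem _ (by omega)).2 (by omega))
    (fun g hg => (hmem _ (by omega)).1 (by omega))
  rwa [show T + 2 * h + e + 3 = t by omega] at this

/-! ### Distributing the clusters -/

theorem exists_disjoint_subsets {U : Finset V} {a b c d : ℕ} (h : a + b + c + d ≤ U.card) :
    ∃ A ⊆ U, ∃ B ⊆ U, ∃ C ⊆ U, ∃ D ⊆ U, A.card = a ∧ B.card = b ∧ C.card = c ∧ D.card = d ∧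
      Disjoint A B ∧ Disjoint A C ∧ Disjoint A D ∧ Disjoint B C ∧ Disjoint B D ∧
      Disjoint C D := by
  obtain ⟨A, hA, cA⟩ := Finset.exists_subset_card_eq (show a ≤ U.card by omega)
  have h1 := Finset.card_sdiff_add_card_eq_card hA
  obtain ⟨B, hB, cB⟩ := Finset.exists_subset_card_eq (show b ≤ (U \ A).card by omega)
  have h2 := Finset.card_sdiff_add_card_eq_card hB
  obtain ⟨C, hC, cC⟩ := Finset.exists_subset_card_eq (show c ≤ ((U \ A) \ B).card by omega)
  have h3 := Finset.card_sdiff_add_card_eq_card hC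
  obtain ⟨D, hD, cD⟩ := Finset.exists_subset_card_eq (show d ≤ (((U \ A) \ B) \ C).card by omega)
  have hC' := hC.trans Finset.sdiff_subset
  have hD' := hD.trans Finset.sdiff_subset
  have hD'' := hD'.trans Finset.sdiff_subset
  refine ⟨A, hA, B, hB.trans Finset.sdiff_subset, C, hC'.trans Finset.sdiff_subset, D,
    hD''.trans Finset.sdiff_subset, cA, cB, cC, cD, ?_, ?_, ?_, ?_, ?_, ?_⟩
  · exact Finset.disjoint_of_subset_right hB Finset.disjoint_sdiff
  · exact Finset.disjoint_of_subset_right hC' Finset.disjoint_sdiff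
  · exact Finset.disjoint_of_subset_right hD'' Finset.disjoint_sdiff
  · exact Finset.disjoint_of_subset_right hC Finset.disjoint_sdiff
  · exact Finset.disjoint_of_subset_right hD' Finset.disjoint_sdiff
  · exact Finset.disjoint_of_subset_right hD Finset.disjoint_sdiff

/-- A layout is cut out of disjoint sets `U i ⊆ C i`, `i < B`. If the clusters repeat with period
`B`, the `Z i` can be continued to `i < B + K` by a second piece of the first `K` sets. -/
theorem exists_layout {C U : ℕ → Finset V} {B K w ρ z z' : ℕ} (hKB : K ≤ B)
    (hUC : ∀ i < B, U i ⊆ C i) (hU : ∀ i < B, ∀ j < B, i ≠ j → Disjoint (U i) (U j))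
    (hC : ∀ i < K, C (i + B) = C i) (hcard : ∀ i < B, w + ρ + z + z' ≤ (U i).card) :
    ∃ W R Z : ℕ → Finset V, Layout C W R Z ∧ (∀ i < B, (W i).card = w) ∧
      (∀ i < B, (R i).card = ρ) ∧ (∀ i < B, (Z i).card = z) ∧
      ∀ i < K, (Z (i + B)).card = z' := by
  have h := fun i (hi : i < B) => exists_disjoint_subsets (hcard i hi)
  choose! P hP Q hQ S hS S' hS' cP cQ cS cS' PQ PS PS' QS QS' SS' using h
  have cross : ∀ {X Y : ℕ → Finset V}, (∀ i < B, X i ⊆ U i) → (∀ i < B, Y i ⊆ U i) →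
      (∀ i < B, Disjoint (X i) (Y i)) → ∀ i < B, ∀ j < B, Disjoint (X i) (Y j) := by
    intro X Y hX hY hXY i hi j hj
    by_cases hij : i = j
    · subst hij; exact hXY i hi
    · exact Finset.disjoint_of_subset_left (hX i hi)
        (Finset.disjoint_of_subset_right (hY j hj) (hU i hi j hj hij))
  have self : ∀ {X : ℕ → Finset V}, (∀ i < B, X i ⊆ U i) →
      ∀ i < B, ∀ j < B, i ≠ j → Disjoint (X i) (X j) := by
    intro X hX i hi j hj hij
    exact Finset.disjoint_of_subset_left (hX i hi)
      (Finset.disjoint_of_subset_right (hX j hj) (hU i hi j hj hij))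
  refine ⟨fun i => if i < B then P i else ∅, fun i => if i < B then Q i else ∅,
    fun i => if i < B then S i else if i < K + B then S' (i - B) else ∅,
    ⟨?_, ?_, ?_, ?_, ?_, ?_, ?_, ?_, ?_⟩, ?_, ?_, ?_, ?_⟩
  · intro i; split_ifs with h
    · exact (hP i h).trans (hUC i h)
    · simp
  · intro i; split_ifs with h
    · exact (hQ i h).trans (hUC i h)
    · simp
  · intro i; split_ifs with h h'
    · exact (hS i h).trans (hUC i h)
    · have := hC (i - B) (by omega)
      rw [show i - B + B = i by omega] at this
      rw [this]
      exact (hS' (i - B) (by omega)).trans (hUC _ (by omega))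
    · simp
  · intro i j hij; simp only [Function.onFun]; split_ifs with h h'
    · exact self hP i h j h' hij
    all_goals simp
  · intro i j hij; simp only [Function.onFun]; split_ifs with h h'
    · exact self hQ i h j h' hij
    all_goals simp
  · intro i j hij; simp only [Function.onFun]; split_ifs with h1 h2 h3 h4 h5 h6
    · exact self hS i h1 j h2 hij
    · exact cross hS hS' SS' i h1 _ (by omega)
    · simp
    · exact (cross hS hS' SS' j h5 _ (by omega)).symm
    · exact self hS' _ (by omega) _ (by omega) (by omega)
    all_goals simp
  · intro i j; split_ifs with h1 h2
    · exact cross hP hQ PQ i h1 j h2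
    all_goals simp
  · intro i j; split_ifs with h1 h2 h3
    · exact cross hP hS PS i h1 j h2
    · exact cross hP hS' PS' i h1 _ (by omega)
    all_goals simp
  · intro i j; split_ifs with h1 h2 h3
    · exact cross hQ hS QS i h1 j h2
    · exact cross hQ hS' QS' i h1 _ (by omega)
    all_goals simp
  · intro i hi; simp [hi, cP]
  · intro i hi; simp [hi, cQ]
  · intro i hi; simp [hi, cS]
  · intro i hi
    beta_reduce
    rw [if_neg (by omega), if_pos (by omega), show i + B - B = i by omega]
    exact cS' i (by omega)

end

section

variable {V : Type*} {G : SimpleGraph V}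

/-! ### Cycles along a path or a cycle of clusters -/

/-- The clusters of a path, followed by empty sets, are consecutively joined. -/
theorem joined_truncate {U : ℕ → Finset V} {q b : ℕ} (hq : 0 < q)
    (hJ : ∀ i < b, Joined G q (U i) (U (i + 1))) (i : ℕ) :
    Joined G q (if i < b + 1 then U i else ∅) (if i + 1 < b + 1 then U (i + 1) else ∅) := by
  by_cases h : i + 1 < b + 1
  · rw [if_pos h, if_pos (by omega)]
    exact hJ i (by omega)
  · rw [if_neg h]
    intro X _ Y hY _ hYq
    rw [Finset.subset_empty.1 hY, Finset.card_empty] at hYq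
    omega

/-- Even cycles of all lengths up to almost the whole size of the clusters of a path of odd
length. -/
theorem hasCycleOfLength_path {U : ℕ → Finset V} {q b M N t : ℕ} (hq : 0 < q) (hb : Odd b)
    (hU : ∀ i < b + 1, ∀ j < b + 1, i ≠ j → Disjoint (U i) (U j))
    (hJ : ∀ i < b, Joined G q (U i) (U (i + 1))) (hM : ∀ i < b + 1, M ≤ (U i).card)
    (hN : b + 7 * q ≤ N) (hNM : N + 17 * q + 6 ≤ M) (hpar : Even t)
    (ht : 2 * (Nat.log 2 (q / 2 + 1) + 3) + 4 ≤ t) (ht' : t + 6 * q ≤ N * (b + 1)) :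
    HasCycleOfLength G t := by
  classical
  obtain ⟨r, rfl⟩ := hb
  obtain ⟨h, -, hh, htree⟩ := exists_twoTrees_odd G (a := q / 2 + 1) (q := q) le_rfl (by omega)
    (by omega)
  obtain ⟨W, R, Z, hL, hW, hR, hZ, -⟩ := exists_layout
    (C := fun i => if i < 2 * r + 1 + 1 then U i else ∅) (U := U) (B := 2 * r + 1 + 1) (K := 0)
    (w := N + 4 * q) (ρ := (2 + 4) * (q + (q / 2 + 1)) + 2 * q) (z := 2 * q) (z' := 0) (by omega)
    (fun i hi => by rw [if_pos hi]) hU (by simp) (fun i hi => by have := hM i hi; omega)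
  refine hL.hasCycleOfLength_of_le hq (joined_truncate hq hJ) htree (r := r) (e := 0) (N := N)
    (by omega) (fun i hi => (hW i (by omega)).ge) (fun i hi => (hR i (by omega)).ge)
    (fun i hi => (hZ i (by omega)).ge) (by simp) ?_ (by omega) ?_
  · rw [Nat.even_iff] at hpar
    simpa using hpar
  · calc t + 6 * q ≤ N * (2 * r + 1 + 1) := ht'
      _ = 2 * N * (r + 1) := by ring

/-- Short even cycles in a single joined pair. -/
theorem hasCycleOfLength_path_short {U : ℕ → Finset V} {q b a d M N t : ℕ} (hq : 0 < q) (hb : 0 < b)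
    (hU : ∀ i < b + 1, ∀ j < b + 1, i ≠ j → Disjoint (U i) (U j))
    (hJ : ∀ i < b, Joined G q (U i) (U (i + 1))) (hM : ∀ i < b + 1, M ≤ (U i).card)
    (hd : 2 ≤ d) (ha : 0 < a) (hda : q ≤ d * a)
    (hNM : N + 2 * q + ((d + 4) * (q + a) + 2 * q) + 2 * q ≤ M) (hpar : Even t)
    (ht : 2 * (Nat.log d a + 3) + 4 ≤ t) (ht' : t + 4 * q ≤ 2 * N) :
    HasCycleOfLength G t := by
  classical
  obtain ⟨h, -, hh, htree⟩ := exists_twoTrees_odd G hd ha hda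
  obtain ⟨W, R, Z, hL, hW, hR, hZ, -⟩ := exists_layout
    (C := fun i => if i < b + 1 then U i else ∅) (U := U) (B := b + 1) (K := 0)
    (w := N + 2 * q) (ρ := (d + 4) * (q + a) + 2 * q) (z := 2 * q) (z' := 0) (by omega)
    (fun i hi => by rw [if_pos hi]) hU (by simp) (fun i hi => by have := hM i hi; omega)
  refine hL.hasCycleOfLength_of_le_single hq (joined_truncate hq hJ) htree (e := 0) (N := N)
    (fun i hi => (hW i (by omega)).ge) (fun i hi => (hR i (by omega)).ge)
    (fun i hi => (hZ i (by omega)).ge) rfl ?_ (by omega) ht'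
  rw [Nat.even_iff] at hpar
  simpa using hpar

/-- The clusters of a cycle, repeated periodically, are consecutively joined. -/
theorem joined_periodic {U : ℕ → Finset V} {q b : ℕ} (hb : 0 < b)
    (hJ : ∀ i, i + 1 < b → Joined G q (U i) (U (i + 1))) (hJ' : Joined G q (U (b - 1)) (U 0))
    (i : ℕ) : Joined G q (U (i % b)) (U ((i + 1) % b)) := by
  have hlt := Nat.mod_lt i hb
  by_cases h : i % b + 1 < b
  · have : (i + 1) % b = i % b + 1 := by
      rw [← Nat.mod_add_mod, Nat.mod_eq_of_lt h]
    rw [this]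
    exact hJ _ h
  · have : (i + 1) % b = 0 := by
      rw [← Nat.mod_add_mod, show i % b + 1 = b by omega, Nat.mod_self]
    rw [this, show i % b = b - 1 by omega]
    exact hJ'

/-- Odd cycles of all lengths up to almost the whole size of the clusters of a cycle of odd length
`b`. Each cluster is halved, and the `2 * b` halves are paired up by going round the cycle twice. -/
theorem hasCycleOfLength_cycle {U : ℕ → Finset V} {q b M N t : ℕ} (hq : 0 < q) (hb : Odd b)
    (hU : ∀ i < b, ∀ j < b, i ≠ j → Disjoint (U i) (U j))
    (hJ : ∀ i, i + 1 < b → Joined G q (U i) (U (i + 1))) (hJ' : Joined G q (U (b - 1)) (U 0))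
    (hM : ∀ i < b, M ≤ (U i).card)
    (hN : b + 7 * q ≤ N) (hNM : 2 * N + 38 * q + 12 ≤ M) (hpar : Odd t)
    (ht : 2 * (Nat.log 2 (q / 2 + 1) + 3) + 4 + b ≤ t) (ht' : t + 6 * q ≤ 2 * N * b) :
    HasCycleOfLength G t := by
  classical
  have hb0 : 0 < b := hb.pos
  obtain ⟨r, rfl⟩ : ∃ r, b = r + 1 := ⟨b - 1, by omega⟩
  obtain ⟨h, -, hh, htree⟩ := exists_twoTrees_odd G (a := q / 2 + 1) (q := q) le_rfl (by omega)
    (by omega)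
  have hhalf : ∀ i < r + 1, ∃ A ⊆ U i, ∃ B ⊆ U i, A.card = N + 19 * q + 6 ∧
      B.card = N + 19 * q + 6 ∧ Disjoint A B := by
    intro i hi
    obtain ⟨A, hA, B, hB, -, -, -, -, cA, cB, -, -, hAB, -⟩ := exists_disjoint_subsets (U := U i)
      (a := N + 19 * q + 6) (b := N + 19 * q + 6) (c := 0) (d := 0)
      (by have := hM i hi; omega)
    exact ⟨A, hA, B, hB, cA, cB, hAB⟩
  choose! A hA B hB cA cB hAB using hhalf
  have hmod : ∀ i < r + 1, i % (r + 1) = i := fun i hi => Nat.mod_eq_of_lt hi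
  have hmod' : ∀ i, r + 1 ≤ i → i < 2 * (r + 1) → i % (r + 1) = i - (r + 1) := fun i hi hi' => by
    rw [Nat.mod_eq_sub_mod hi, Nat.mod_eq_of_lt (by omega)]
  have hsub : ∀ i < 2 * (r + 1), (if i < r + 1 then A i else B (i - (r + 1))) ⊆ U (i % (r + 1)) := by
    intro i hi
    split_ifs with h
    · rw [hmod i h]; exact hA i h
    · rw [hmod' i (by omega) hi]; exact hB _ (by omega)
  obtain ⟨W, R, Z, hL, hW, hR, hZ, hZ'⟩ := exists_layout
    (C := fun i => U (i % (r + 1))) (U := fun i => if i < r + 1 then A i else B (i - (r + 1)))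
    (B := 2 * (r + 1)) (K := r + 1) (w := N + 4 * q)
    (ρ := (2 + 4) * (q + (q / 2 + 1)) + 2 * q) (z := 2 * q) (z' := 2 * q) (by omega)
    hsub
    (by
      intro i hi j hj hij
      by_cases hc : i % (r + 1) = j % (r + 1)
      · -- the two halves of one cluster
        split_ifs with h1 h2 h2
        · rw [hmod i h1, hmod j h2] at hc; omega
        · rw [hmod i h1, hmod' j (by omega) hj] at hc; rw [← hc]; exact hAB i h1
        · rw [hmod' i (by omega) hi, hmod j h2] at hc; rw [hc]; exact (hAB j h2).symm
        · rw [hmod' i (by omega) hi, hmod' j (by omega) hj] at hc; omega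
      · exact Finset.disjoint_of_subset_left (hsub i hi) (Finset.disjoint_of_subset_right (hsub j hj)
          (hU _ (Nat.mod_lt _ hb0) _ (Nat.mod_lt _ hb0) hc)))
    (by
      intro i hi
      simp only [Nat.add_mul_mod_self_right])
    (by
      intro i hi
      split_ifs with h
      · rw [cA i h]; omega
      · rw [cB _ (by omega)]; omega)
  refine hL.hasCycleOfLength_of_le hq (joined_periodic hb0 hJ hJ') htree (r := r) (e := r + 1)
    (N := N) (by omega) (fun i hi => (hW i (by omega)).ge) (fun i hi => (hR i (by omega)).ge)
    (fun i hi => ?_) (fun j _ => by simp only [Nat.add_mod_right]) ?_ (by omega) ht'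
  · by_cases hi' : i < 2 * (r + 1)
    · exact (hZ i hi').ge
    · have := hZ' (i - 2 * (r + 1)) (by omega)
      rw [show i - 2 * (r + 1) + 2 * (r + 1) = i by omega] at this
      exact this.ge
  · rw [Nat.odd_iff] at hpar hb
    omega

/-- Short odd cycles: a path in one pair, closed by going round the cycle once. -/
theorem hasCycleOfLength_cycle_short {U : ℕ → Finset V} {q b a d M N t : ℕ} (hq : 0 < q)
    (hb : Odd b) (hb2 : 2 ≤ b) (hU : ∀ i < b, ∀ j < b, i ≠ j → Disjoint (U i) (U j))
    (hJ : ∀ i, i + 1 < b → Joined G q (U i) (U (i + 1))) (hJ' : Joined G q (U (b - 1)) (U 0))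
    (hM : ∀ i < b, M ≤ (U i).card) (hd : 2 ≤ d) (ha : 0 < a) (hda : q ≤ d * a)
    (hNM : N + 2 * q + ((d + 4) * (q + a) + 2 * q) + 2 * q ≤ M) (hpar : Odd t)
    (ht : 2 * (Nat.log d a + 3) + 4 + b ≤ t) (ht' : t + 4 * q ≤ 2 * N) :
    HasCycleOfLength G t := by
  classical
  obtain ⟨h, -, hh, htree⟩ := exists_twoTrees_odd G hd ha hda
  obtain ⟨W, R, Z, hL, hW, hR, hZ, -⟩ := exists_layout
    (C := fun i => U (i % b)) (U := U) (B := b) (K := 0)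
    (w := N + 2 * q) (ρ := (d + 4) * (q + a) + 2 * q) (z := 2 * q) (z' := 0) (by omega)
    (fun i hi => by rw [Nat.mod_eq_of_lt hi]) hU (by simp)
    (fun i hi => by have := hM i hi; omega)
  refine hL.hasCycleOfLength_of_le_single hq (joined_periodic (by omega) hJ hJ') htree (e := b)
    (N := N) (fun i hi => (hW i (by omega)).ge) (fun i hi => (hR i (by omega)).ge)
    (fun i hi => (hZ i (by omega)).ge) (by simp) ?_ (by omega) ht'
  rw [Nat.odd_iff] at hpar hb
  omega

/-! ### The choice of parameters -/

theorem natLog_le_log_div {b x : ℕ} {n : ℝ} (hb : 2 ≤ b) (hx : 0 < x) (hxn : (x : ℝ) ≤ n) :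
    (Nat.log b x : ℝ) ≤ Real.log n / Real.log b := by
  have hb' : (2 : ℝ) ≤ b := by exact_mod_cast hb
  have hx' : (0 : ℝ) < x := by exact_mod_cast hx
  rw [le_div_iff₀ (Real.log_pos (by linarith)), ← Real.log_pow]
  refine Real.log_le_log (by positivity) (le_trans ?_ hxn)
  exact_mod_cast Nat.pow_log_le_self b hx.ne'

/-- A branching factor slightly below `1 / ε` still gives trees of depth less than
`1.05 * log n / log (1 / ε)`. -/
theorem two_div_log_lt {u d : ℝ} (hu : 85 < u) (hd : 14 * u / 17 ≤ d) :
    2 / Real.log d < 21 / 10 / Real.log u := by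
  have hlogu : 0 < Real.log u := Real.log_pos (by linarith)
  have hlogd : 0 < Real.log d := Real.log_pos (by linarith)
  have key : u ^ 20 < d ^ 21 := by
    -- with `v = u / 85 ≥ 1`, this is `85 ^ 20 < 70 ^ 21`
    obtain ⟨v, rfl⟩ : ∃ v, u = 85 * v := ⟨u / 85, by ring⟩
    have hv : 1 ≤ v := by linarith
    have h1 : (70 * v) ^ 21 ≤ d ^ 21 := pow_le_pow_left₀ (by linarith) (by linarith) 21
    have h2 : v ^ 20 ≤ v ^ 21 := pow_le_pow_right₀ hv (by omega)
    have h3 : 0 < v ^ 20 := by positivity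
    rw [mul_pow] at h1 ⊢
    have h4 : (85 : ℝ) ^ 20 < 70 ^ 21 := by norm_num
    calc (85 : ℝ) ^ 20 * v ^ 20 < 70 ^ 21 * v ^ 20 := mul_lt_mul_of_pos_right h4 h3
      _ ≤ 70 ^ 21 * v ^ 21 := mul_le_mul_of_nonneg_left h2 (by positivity)
      _ ≤ _ := h1
  have h := Real.log_lt_log (by positivity) key
  rw [Real.log_pow, Real.log_pow] at h
  push_cast at h
  rw [div_lt_div_iff₀ hlogd hlogu]
  linarith

/-- For large `n`, the quantity `x = ε * n / k` dominates all constants and `log n`, and the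
short-cycle trees fit below the lower end of the range of lengths. -/
theorem exists_forall_large {ε : ℝ} (hε₀ : 0 < ε) (hε₁ : ε < 1 / 85) {k : ℕ} (hk : 0 < k) {d : ℕ}
    (hd : 14 * (1 / ε) / 17 ≤ d) (K : ℝ) :
    ∃ n₀ : ℕ, ∀ n : ℕ, n₀ ≤ n → 1 ≤ n ∧ K ≤ ε * (n / k) ∧
      Real.log n ≤ ε * (n / k) / 1000 ∧
      2 / Real.log d * Real.log n + (10 + k) ≤ 21 / 10 / Real.log (1 / ε) * Real.log n := by
  have hu : 85 < 1 / ε := by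
    rw [lt_div_iff₀ hε₀]
    linarith
  have hk' : (0 : ℝ) < k := by exact_mod_cast hk
  have hδ := sub_pos.2 (two_div_log_lt hu hd)
  have hc : 0 < ε / k := by positivity
  have h1 : ∀ᶠ n : ℕ in Filter.atTop, K ≤ (ε / k) * n :=
    (tendsto_natCast_atTop_atTop.const_mul_atTop hc).eventually_ge_atTop K
  have h2 : ∀ᶠ n : ℕ in Filter.atTop,
      10 + (k : ℝ) ≤ (21 / 10 / Real.log (1 / ε) - 2 / Real.log d) * Real.log n :=
    ((Real.tendsto_log_atTop.comp tendsto_natCast_atTop_atTop).const_mul_atTop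
      hδ).eventually_ge_atTop _
  have h3 : ∀ᶠ n : ℕ in Filter.atTop, ‖Real.log n‖ ≤ ε / k / 1000 * ‖((n : ℝ))‖ :=
    tendsto_natCast_atTop_atTop.eventually
      (Real.isLittleO_log_id_atTop.def (by positivity : 0 < ε / k / 1000))
  obtain ⟨n₀, h⟩ := Filter.eventually_atTop.1
    ((Filter.eventually_ge_atTop 1).and (h1.and (h2.and h3)))
  refine ⟨n₀, fun n hn => ?_⟩
  obtain ⟨g0, g1, g2, g3⟩ := h n hn
  have e : ε * ((n : ℝ) / k) = ε / k * n := by ring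
  rw [e]
  refine ⟨g0, g1, ?_, by linarith⟩
  have := (le_abs_self _).trans g3
  rw [Real.norm_of_nonneg (by positivity)] at this
  linarith

/-- All clusters have almost average size. -/
theorem BalancedPartition.le_card_part [Fintype V] {k : ℕ} (P : BalancedPartition V k)
    (i : Fin k) : (Fintype.card V : ℝ) / k - 1 ≤ (P.part i).card := by
  classical
  have hk : (0 : ℝ) < k := by exact_mod_cast i.pos
  have h : Fintype.card V ≤ k * ((P.part i).card + 1) := by
    calc Fintype.card V = (Finset.univ.biUnion P.part).card := by
          rw [← Finset.card_univ]
          congr 1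
          ext v
          simpa using P.cover v
      _ ≤ ∑ j, (P.part j).card := Finset.card_biUnion_le
      _ ≤ ∑ _j : Fin k, ((P.part i).card + 1) := Finset.sum_le_sum fun j _ => P.balanced j i
      _ = _ := by simp
  have h' : (Fintype.card V : ℝ) ≤ k * ((P.part i).card + 1) := by exact_mod_cast h
  rw [sub_le_iff_le_add, div_le_iff₀ hk]
  linarith

theorem EpsProperty.joined {ε m : ℝ} {A B : Finset V} {q : ℕ} (h : EpsProperty G ε m A B)
    (hq : ε * m ≤ q) : Joined G q A B := by
  intro X hX Y hY cX cY
  exact h X hX Y hY (hq.trans (by exact_mod_cast cX)) (hq.trans (by exact_mod_cast cY))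

/-- What the proof requires of the parameters for one value of `n`: `q` is meant to be
`⌈ε * n / k⌉`, `d` is the branching factor of the trees for short cycles, `M` bounds the cluster sizes
from below, and lengths `t ≤ q / 20` count as short. Trees branch up to level size `q / 60 + 1` for
short cycles, and up to `q / 2 + 1`, with branching factor `2`, for long ones. -/
structure Parameters (ε : ℝ) (n k q d : ℕ) : Prop where
  q_pos : 0 < q
  le_q : ε * (n / k) ≤ q
  two_le_d : 2 ≤ d
  q_le : q ≤ d * (q / 60 + 1)
  short_size : ∀ M t : ℕ, (n : ℝ) / k - 1 ≤ M → 20 * t ≤ q →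
    (2 * q + t) + 2 * q + ((d + 4) * (q + (q / 60 + 1)) + 2 * q) + 2 * q ≤ M
  short_length : ∀ t : ℕ, 21 / 10 / Real.log (1 / ε) * Real.log n ≤ t →
    2 * (Nat.log d (q / 60 + 1) + 3) + 4 + k ≤ t
  long_length : ∀ t : ℕ, q < 20 * t → 2 * (Nat.log 2 (q / 2 + 1) + 3) + 4 + k ≤ t
  long_path_size : ∀ M : ℕ, (n : ℝ) / k - 1 ≤ M → k + 7 * q + 17 * q + 6 ≤ M
  long_path_bound : ∀ M N b t : ℕ, (n : ℝ) / k - 1 ≤ M → M = N + 17 * q + 6 → 1 ≤ b →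
    (t : ℝ) ≤ (1 - 48 * ε) * (((b : ℝ) + 1) / k) * n → t + 6 * q ≤ N * (b + 1)
  long_cycle_size : ∀ M : ℕ, (n : ℝ) / k - 1 ≤ M → 2 * (k + 7 * q) + 38 * q + 12 ≤ M
  long_cycle_bound : ∀ M N b t : ℕ, (n : ℝ) / k - 1 ≤ M → M ≤ 2 * N + 38 * q + 13 → 3 ≤ b →
    (t : ℝ) ≤ (1 - 48 * ε) * ((b : ℝ) / k) * n → t + 6 * q ≤ 2 * N * b

/-- With `u = 1 / ε` and `x = ε * n / k`, the sizes to be compared are `M ≥ u * x - 1` and multiples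
of `q ≤ x + 1`, so that each inequality has a surplus proportional to `x`. -/
theorem exists_parameters {ε : ℝ} (hε₀ : 0 < ε) (hε₁ : ε < 1 / 85) {k : ℕ} (hk : 0 < k) :
    ∃ n₀ : ℕ, ∀ n : ℕ, n₀ ≤ n → ∃ q d : ℕ, Parameters ε n k q d := by
  have hu : 85 < 1 / ε := by
    rw [lt_div_iff₀ hε₀]
    linarith
  set u := 1 / ε with hu_def
  -- `14 / 17 = 70 / 85` is small enough for the reserved sets and large enough for `two_div_log_lt`
  set d := ⌈14 * u / 17⌉₊ with hd_def
  have hd : 14 * u / 17 ≤ d := Nat.le_ceil _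
  have hd' : (d : ℝ) < 14 * u / 17 + 1 := Nat.ceil_lt_add_one (by positivity)
  have hd70 : 70 ≤ d := by
    have : (70 : ℝ) < d := by linarith
    exact_mod_cast this.le
  have hk' : (0 : ℝ) < k := by exact_mod_cast hk
  obtain ⟨n₀, h⟩ := exists_forall_large hε₀ hε₁ hk hd (1000 + 100 * k + 10 * u)
  refine ⟨n₀, fun n hn => ?_⟩
  obtain ⟨hn1, hK, hlog, hlog'⟩ := h n hn
  set x := ε * ((n : ℝ) / k) with hx
  have hm : (n : ℝ) / k = u * x := by
    rw [hx, hu_def]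
    field_simp
  have hx0 : 0 < x := by linarith
  have hux : 85 * x ≤ u * x := mul_le_mul_of_nonneg_right hu.le hx0.le
  set q := ⌈x⌉₊ with hq_def
  have hq : x ≤ q := Nat.le_ceil _
  have hq' : (q : ℝ) < x + 1 := Nat.ceil_lt_add_one hx0.le
  have hq0 : 0 < q := Nat.ceil_pos.2 hx0
  have hn1' : (1 : ℝ) ≤ n := by exact_mod_cast hn1
  have hlogn : 0 ≤ Real.log n := Real.log_nonneg hn1'
  have hqn : (q : ℝ) + 1 ≤ n := by
    have h1 : (n : ℝ) / k ≤ n := div_le_self (by linarith) (by exact_mod_cast hk)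
    linarith
  have hε48 : ∀ b : ℝ, (1 - 48 * ε) * (b / k) * n = b * (u * x - 48 * x) := by
    intro b
    rw [← hm, hx]
    ring
  have key2 : 2 * (Nat.log 2 (q / 2 + 1) : ℝ) ≤ 3 * (x / 1000) := by
    have h1 : ((q / 2 + 1 : ℕ) : ℝ) ≤ n := by
      have : q / 2 + 1 ≤ q + 1 := by omega
      have : ((q / 2 + 1 : ℕ) : ℝ) ≤ ((q + 1 : ℕ) : ℝ) := by exact_mod_cast this
      push_cast at this ⊢
      linarith
    have h2 := natLog_le_log_div le_rfl (Nat.succ_pos (q / 2)) h1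
    have h3 : Real.log n / Real.log 2 ≤ 3 / 2 * Real.log n := by
      have := Real.log_two_gt_d9
      rw [div_le_iff₀ (by linarith)]
      nlinarith
    push_cast at h2
    linarith
  refine ⟨q, d, hq0, hq, by omega, ?_, ?_, ?_, ?_, ?_, ?_, ?_, ?_⟩
  · calc q ≤ 60 * (q / 60 + 1) := by omega
      _ ≤ _ := Nat.mul_le_mul_right _ (by omega)
  · intro M t hM ht
    rw [hm] at hM
    have h1 : ((q / 60 : ℕ) : ℝ) ≤ q / 60 := Nat.cast_div_le
    have ht' : 20 * (t : ℝ) ≤ q := by exact_mod_cast ht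
    have h2 : ((d : ℝ) + 4) * (q + ((q / 60 : ℕ) + 1)) ≤
        (14 * u / 17 + 5) * (61 / 60 * (x + 1) + 1) :=
      mul_le_mul (by linarith) (by linarith) (by positivity) (by positivity)
    have h3 : ((2 * q + t + 2 * q + ((d + 4) * (q + (q / 60 + 1)) + 2 * q) + 2 * q : ℕ) : ℝ) ≤
        M := by
      push_cast
      linarith
    exact_mod_cast h3
  · intro t ht
    have h1 : ((q / 60 + 1 : ℕ) : ℝ) ≤ n := by
      have : q / 60 + 1 ≤ q + 1 := by omega
      have : ((q / 60 + 1 : ℕ) : ℝ) ≤ ((q + 1 : ℕ) : ℝ) := by exact_mod_cast this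
      push_cast at this ⊢
      linarith
    have h2 := natLog_le_log_div (b := d) (by omega) (Nat.succ_pos (q / 60)) h1
    have h3 : 2 / Real.log d * Real.log n = 2 * (Real.log n / Real.log d) := by ring
    have h4 : ((2 * (Nat.log d (q / 60 + 1) + 3) + 4 + k : ℕ) : ℝ) ≤ t := by
      push_cast at h2 ⊢
      linarith
    exact_mod_cast h4
  · intro t ht
    have ht' : (q : ℝ) < 20 * t := by exact_mod_cast ht
    have h4 : ((2 * (Nat.log 2 (q / 2 + 1) + 3) + 4 + k : ℕ) : ℝ) ≤ t := by
      push_cast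
      linarith
    exact_mod_cast h4
  · intro M hM
    rw [hm] at hM
    have : ((k + 7 * q + 17 * q + 6 : ℕ) : ℝ) ≤ M := by
      push_cast
      linarith
    exact_mod_cast this
  · intro M N b t hM hMN hb ht
    rw [hε48] at ht
    rw [hm, hMN] at hM
    push_cast at hM
    have hb' : (1 : ℝ) ≤ b := by exact_mod_cast hb
    have h1 : ((b : ℝ) + 1) * (u * x - 48 * x + 30 * x) ≤ (b + 1) * N :=
      mul_le_mul_of_nonneg_left (by linarith) (by positivity)
    have h2 : 2 * (30 * x) ≤ ((b : ℝ) + 1) * (30 * x) :=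
      mul_le_mul_of_nonneg_right (by linarith) (by positivity)
    have : ((t + 6 * q : ℕ) : ℝ) ≤ ((N * (b + 1) : ℕ) : ℝ) := by
      push_cast
      linarith
    exact_mod_cast this
  · intro M hM
    rw [hm] at hM
    have : ((2 * (k + 7 * q) + 38 * q + 12 : ℕ) : ℝ) ≤ M := by
      push_cast
      linarith
    exact_mod_cast this
  · intro M N b t hM hMN hb ht
    rw [hε48] at ht
    rw [hm] at hM
    have hMN' : (M : ℝ) ≤ 2 * N + 38 * q + 13 := by exact_mod_cast hMN
    have hb' : (3 : ℝ) ≤ b := by exact_mod_cast hb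
    have h1 : (b : ℝ) * (u * x - 48 * x + 9 * x) ≤ b * (2 * N) :=
      mul_le_mul_of_nonneg_left (by linarith) (by positivity)
    have h2 : 3 * (9 * x) ≤ (b : ℝ) * (9 * x) :=
      mul_le_mul_of_nonneg_right (by linarith) (by positivity)
    have : ((t + 6 * q : ℕ) : ℝ) ≤ ((2 * N * b : ℕ) : ℝ) := by
      push_cast
      linarith
    exact_mod_cast this

end

end KeyLemma

theorem mainTheorem2 (ε : ℝ) (hε₀ : 0 < ε) (hε₁ : ε < 1 / 85)
    (k : ℕ) (hk : 2 / ε ^ 2 ≤ (k : ℝ)) :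
    ∃ n₀ : ℕ, ∀ n : ℕ, n₀ ≤ n →
      ∀ (V : Type*) [Fintype V], Fintype.card V = n →
      ∀ (G₀ : SimpleGraph V) (P : KeyLemma.BalancedPartition V k),
      ∀ C₁ : ℝ, (21 / 10 : ℝ) < C₁ →
        (∀ b : ℕ, Odd b → 1 ≤ b → b < k →
          KeyLemma.HasPathOfLength (KeyLemma.epsGraph G₀ P ε) b →
          ∀ t : ℕ, Even t →
            C₁ / Real.log (1 / ε) * Real.log (n : ℝ) ≤ (t : ℝ) →
            (t : ℝ) ≤ (1 - 48 * ε) * (((b : ℝ) + 1) / (k : ℝ)) * (n : ℝ) →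
            KeyLemma.HasCycleOfLength G₀ t) ∧
        (∀ b : ℕ, Odd b → 3 ≤ b → b < k →
          KeyLemma.HasCycleOfLength (KeyLemma.epsGraph G₀ P ε) b →
          ∀ t : ℕ, Odd t →
            (((b : ℝ) - 1) * C₁) / (2 * Real.log (1 / ε)) * Real.log (n : ℝ) ≤ (t : ℝ) →
            (t : ℝ) ≤ (1 - 48 * ε) * ((b : ℝ) / (k : ℝ)) * (n : ℝ) →
            KeyLemma.HasCycleOfLength G₀ t) := by
  have hk0 : 0 < k := by
    have : (0 : ℝ) < k := lt_of_lt_of_le (by positivity) hk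
    exact_mod_cast this
  have hlogu : 0 < Real.log (1 / ε) := by
    refine Real.log_pos ?_
    rw [lt_div_iff₀ hε₀]
    linarith
  obtain ⟨n₀, h⟩ := KeyLemma.exists_parameters hε₀ hε₁ hk0
  refine ⟨n₀, fun n hn V _ hV G₀ P C₁ hC₁ => ?_⟩
  obtain ⟨q, d, hp⟩ := h n hn
  have hlogn : 0 ≤ Real.log (n : ℝ) := Real.log_natCast_nonneg n
  -- a common lower bound for the cluster sizes
  obtain ⟨M, hM, hMle⟩ : ∃ M : ℕ, (n : ℝ) / k - 1 ≤ M ∧ ∀ i, M ≤ (P.part i).card := by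
    refine ⟨⌈(n : ℝ) / k - 1⌉₊, Nat.le_ceil _, fun i => Nat.ceil_le.2 ?_⟩
    rw [← hV]
    exact P.le_card_part i
  have hadj : ∀ {i j}, (KeyLemma.epsGraph G₀ P ε).Adj i j →
      KeyLemma.Joined G₀ q (P.part i) (P.part j) := fun {i j} hij => by
    refine hij.2.joined ?_
    rw [hV]
    exact hp.le_q
  refine ⟨?_, ?_⟩
  · rintro b hb hb1 hbk ⟨c, c', p, hpath, rfl⟩ t ht hlow hup
    have hlow' : 21 / 10 / Real.log (1 / ε) * Real.log n ≤ t := by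
      refine le_trans (mul_le_mul_of_nonneg_right ?_ hlogn) hlow
      gcongr
    have hU : ∀ i < p.length + 1, ∀ j < p.length + 1, i ≠ j →
        Disjoint (P.part (p.getVert i)) (P.part (p.getVert j)) := by
      intro i hi j hj hij
      refine P.disjoint _ _ fun he => hij ?_
      exact hpath.getVert_injOn (by simp; omega) (by simp; omega) he
    have hJ : ∀ i < p.length,
        KeyLemma.Joined G₀ q (P.part (p.getVert i)) (P.part (p.getVert (i + 1))) :=
      fun i hi => hadj (p.adj_getVert_succ hi)
    by_cases hshort : 20 * t ≤ q
    · refine KeyLemma.hasCycleOfLength_path_short (U := fun i => P.part (p.getVert i))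
        (a := q / 60 + 1) hp.q_pos hb1
        hU hJ (fun i _ => hMle _) hp.two_le_d (Nat.succ_pos _) hp.q_le
        (hp.short_size M t hM hshort) ht ?_ (by omega)
      have := hp.short_length t hlow'
      omega
    · have h1 := hp.long_path_size M hM
      have h2 := hp.long_length t (by omega)
      refine KeyLemma.hasCycleOfLength_path (U := fun i => P.part (p.getVert i))
        (N := M - (17 * q + 6)) hp.q_pos hb hU hJ (fun i _ => hMle _) (by omega) (by omega) ht
        (by omega) ?_
      exact hp.long_path_bound M _ _ t hM (by omega) hb1 hup
  · rintro b hb hb3 hbk ⟨c, p, hcyc, rfl⟩ t ht hlow hup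
    have hlow' : 21 / 10 / Real.log (1 / ε) * Real.log n ≤ t := by
      refine le_trans (mul_le_mul_of_nonneg_right ?_ hlogn) hlow
      have hb' : (3 : ℝ) ≤ p.length := by exact_mod_cast hb3
      rw [div_le_div_iff₀ hlogu (by positivity)]
      have : 2 * C₁ ≤ ((p.length : ℝ) - 1) * C₁ :=
        mul_le_mul_of_nonneg_right (by linarith) (by linarith)
      nlinarith
    have hU : ∀ i < p.length, ∀ j < p.length, i ≠ j →
        Disjoint (P.part (p.getVert i)) (P.part (p.getVert j)) := by
      intro i hi j hj hij
      refine P.disjoint _ _ fun he => hij ?_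
      exact hcyc.getVert_injOn' (by simp; omega) (by simp; omega) he
    have hJ : ∀ i, i + 1 < p.length →
        KeyLemma.Joined G₀ q (P.part (p.getVert i)) (P.part (p.getVert (i + 1))) :=
      fun i hi => hadj (p.adj_getVert_succ (by omega))
    have hJ' : KeyLemma.Joined G₀ q (P.part (p.getVert (p.length - 1)))
        (P.part (p.getVert 0)) := by
      refine hadj ?_
      have := p.adj_getVert_succ (show p.length - 1 < p.length by omega)
      rw [p.getVert_zero]
      rwa [show p.length - 1 + 1 = p.length by omega, p.getVert_length] at this
    by_cases hshort : 20 * t ≤ q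
    · refine KeyLemma.hasCycleOfLength_cycle_short (U := fun i => P.part (p.getVert i))
        (a := q / 60 + 1) hp.q_pos hb
        (by omega) hU hJ hJ' (fun i _ => hMle _) hp.two_le_d (Nat.succ_pos _) hp.q_le
        (hp.short_size M t hM hshort) ht ?_ (by omega)
      have := hp.short_length t hlow'
      omega
    · have h1 := hp.long_cycle_size M hM
      have h2 := hp.long_length t (by omega)
      refine KeyLemma.hasCycleOfLength_cycle (U := fun i => P.part (p.getVert i))
        (N := (M - (38 * q + 12)) / 2) hp.q_pos hb hU hJ hJ' (fun i _ => hMle _) (by omega)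
        (by omega) ht (by omega) ?_
      exact hp.long_cycle_bound M _ _ t hM (by omega) hb3 hup
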